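/- Let $\mathbb T=\mathbb R/2\pi\mathbb Z$ (identified with $[0,2\pi)$) and write $\|\cdot\|_{L^1}$ for the norm of $L^1(\mathbb T\times\mathbb R,d\theta dv)$ and $|A|$ for the Lebesgue measure of $A\subset\mathbb T\times\mathbb R$. For $f\in L^1(\mathbb T\times\mathbb R)$ put $\rho_f(\theta)=\int_{\mathbb R}f(\theta,v)\,dv$ and $\phi_f(\theta)=-\int_0^{2\pi}\rho_f(\theta')\cos(\theta-\theta')\,d\theta'$. For $f\ge 0$ put $\mu_f(s)=|\{f>s\}|$ and $f^\sharp(s)=\inf\{t\ge 0:\mu_f(t)\le s\}$ for $s\ge0$, and $f^*(\theta,v)=f^\sharp\big(|B(0,\sqrt{\theta^2+v^2})\cap(\mathbb T\times\mathbb R)|\big)$, where $B(0,R)$ is the open Euclidean ball. For nonnegative $g,h$ put $\beta_{g,h}(s)=|\{(\theta,v):g(\theta,v)\le s<h(\theta,v)\}|$. Let $m_0>0$, let $e_*\in\mathbb R\cup\{+\infty\}$, and let $F:\mathbb R\to\mathbb R$ be continuous, of class $C^1$ on $(-\infty,e_*)$ with $F'<0$ there, with $F(e)=0$ for $e\ge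 e_*$ if $e_*<+\infty$, and $\lim_{e\to+\infty}F(e)=0$ if $e_*=+\infty$. Let $f_0(\theta,v)=F\big(\tfrac{v^2}{2}-m_0\cos\theta\big)$, and assume that $f_0\in L^1((1+v^2)\,d\theta dv)$ and that $\phi_{f_0}(\theta)=-m_0\cos\theta$ for all $\theta$. If $e_*=m_0$, assume moreover that $\int_{-m_0}^{m_0}\log(m_0-e)F'(e)\,de<+\infty$. Then there is a constant $K_0>0$ depending only on $f_0$ such that, for all nonnegative $f\in L^1((1+v^2)\,d\theta dv)$, $$\left(\|f-f_0\|_{L^1}+\|f_0\|_{L^1}-\|f\|_{L^1}\right)^2\le K_0\left[\iint\Big(\frac{v^2}{2}+\phi_{f_0}(\theta)\Big)(f-f_0)\,d\theta dv+m_0\|f^*-f_0^*\|_{L^1}+\frac1{8\pi^2}\int_0^{+\infty}\mu_{f_0}(s)^2\beta_{f^*,f_0^*}(s)\,ds\right],$$ and the three terms in the bracket are finite. -/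

import Mathlib

open MeasureTheory Set Filter Topology
open scoped ENNReal

noncomputable section

namespace HMF

/-- Lebesgue measure `dθ dv` on the phase space `𝕋 × ℝ`, where the flat torus `𝕋` of length `2π`
is identified with its fundamental domain `[0, 2π)`. A point is a pair `(θ, v)`. A function on
`𝕋 × ℝ` is represented by a function on `ℝ × ℝ`, of which only the values on the strip
`[0, 2π) × ℝ` matter. -/
def phase : Measure (ℝ × ℝ) :=
  (volume.restrict (Ico (0 : ℝ) (2 * Real.pi))).prod volume

/-- Membership in the energy space `L¹((1 + v²) dθ dv)`. -/
def InEnergySpace (f : ℝ × ℝ → ℝ) : Prop :=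
  Integrable (fun p : ℝ × ℝ => (1 + p.2 ^ 2) * f p) phase

/-- The `L¹` norm on phase space. -/
def normL1 (f : ℝ × ℝ → ℝ) : ℝ := ∫ p, |f p| ∂phase

/-- The density `ρ_f(θ) = ∫ f(θ, v) dv`. -/
def density (f : ℝ × ℝ → ℝ) (θ : ℝ) : ℝ := ∫ v : ℝ, f (θ, v)

/-- The self-consistent potential `φ_f(θ) = - ∫₀^{2π} ρ_f(θ') cos (θ - θ') dθ'`. -/
def potential (f : ℝ × ℝ → ℝ) (θ : ℝ) : ℝ :=
  -∫ θ' in (0 : ℝ)..(2 * Real.pi), density f θ' * Real.cos (θ - θ')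

/-- The function `(θ, v) ↦ F(v²/2 - m₀ cos θ)`. -/
def profile (F : ℝ → ℝ) (m₀ : ℝ) (p : ℝ × ℝ) : ℝ :=
  F (p.2 ^ 2 / 2 + -m₀ * Real.cos p.1)

/-- `f₀` is a steady state `f₀(θ, v) = F(v²/2 + φ₀(θ))` with `φ₀ = φ_{f₀} = - m₀ cos`, `m₀ > 0`,
where the profile `F` and the cut-off energy `eStar ∈ ℝ ∪ {+∞}` satisfy the structural
assumptions. -/
structure IsSteadyState (F : ℝ → ℝ) (eStar : WithTop ℝ) (m₀ : ℝ) (f₀ : ℝ × ℝ → ℝ) : Prop where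
  m₀_pos : 0 < m₀
  eq_profile : f₀ = profile F m₀
  self_consistent : ∀ θ : ℝ, potential f₀ θ = -m₀ * Real.cos θ
  continuous : Continuous F
  contDiffOn : ContDiffOn ℝ 1 F {e : ℝ | (e : WithTop ℝ) < eStar}
  deriv_neg : ∀ e : ℝ, (e : WithTop ℝ) < eStar → deriv F e < 0
  eq_zero : ∀ e : ℝ, eStar ≤ (e : WithTop ℝ) → F e = 0
  tendsto_zero : eStar = ⊤ → Tendsto F atTop (𝓝 0)
  energy_space : InEnergySpace f₀
  log_integrable : eStar = (m₀ : WithTop ℝ) →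
    IntegrableOn (fun e : ℝ => Real.log (m₀ - e) * deriv F e) (Ioo (-m₀) m₀)

/-- The distribution function `μ_f(s) = |{f > s}|`, with values in `[0, ∞]`. -/
def distrib (f : ℝ × ℝ → ℝ) (s : ℝ) : ℝ≥0∞ := phase {p | s < f p}

/-- The pseudo-inverse `f^♯(s) = inf {t ≥ 0 : μ_f(t) ≤ s}`, with values in `[0, ∞]`. -/
def sharp (f : ℝ × ℝ → ℝ) (s : ℝ≥0∞) : ℝ≥0∞ :=
  ⨅ (t : ℝ) (_ : 0 ≤ t ∧ distrib f t ≤ s), ENNReal.ofReal t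

/-- The rearrangement `f^*(θ, v) = f^♯(|B(0, √(θ² + v²)) ∩ 𝕋 × ℝ|)`, where `B(0, R)` is the
open Euclidean ball. Its values lie in `[0, ∞]`; for integrable `f` only the value at `(0, 0)`,
which is the essential supremum of `f`, can be infinite. -/
def rearr (f : ℝ × ℝ → ℝ) (p : ℝ × ℝ) : ℝ≥0∞ :=
  sharp f (phase {q : ℝ × ℝ | q.1 ^ 2 + q.2 ^ 2 < p.1 ^ 2 + p.2 ^ 2})

/-- The `L¹` distance `∬ |g - h| dθ dv` of two functions with values in `[0, ∞]`. The subtraction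
in `[0, ∞]` is truncated, so that `|g - h| = (g - h) + (h - g)`. -/
def distL1 (g h : ℝ × ℝ → ℝ≥0∞) : ℝ≥0∞ :=
  ∫⁻ p, ((g p - h p) + (h p - g p)) ∂phase

/-- `β_{g,h}(s) = |{g ≤ s < h}|`. -/
def beta (g h : ℝ × ℝ → ℝ≥0∞) (s : ℝ) : ℝ≥0∞ :=
  phase {p | g p ≤ ENNReal.ofReal s ∧ ENNReal.ofReal s < h p}

/-- `∫₀^∞ μ_{f₀}(s)² β_{f^*,f₀^*}(s) ds`. -/
def betaTerm (f f₀ : ℝ × ℝ → ℝ) : ℝ≥0∞ :=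
  ∫⁻ s in Ioi (0 : ℝ), distrib f₀ s ^ 2 * beta (rearr f) (rearr f₀) s

end HMF

end

/-! The quantity being squared equals `2I`, where `I = ∫ (f₀ - f)₊`. By the layer-cake formula, `I`
is the integral over `s > 0` of `|A \ E|`, with `A = {f₀ > s}` and `E = {f > s}`. Since `F` is
decreasing, `A` is a sub-level set `{energy < c}` for `0 < s < F(-m₀)`, and is empty for larger `s`.

Fix `τ ≥ 0`. Trading a point of `A \ E` for a point outside `A` costs energy at least `τ`, unless
the first point lies in the shell `D` where raising the energy by `τ` makes the profile drop to `s`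
or below. If `|A| ≠ |E|`, the trade is incomplete. The mismatch is paid for by `m₀ ||E| - |A||` and,
when `|E| < |A|`, also by `|A|² (|A| - |E|) / (8π²)`, because `c + m₀ ≤ 2m₀ + |A|² / (8π²)`
(`level_le_of_phase_sublevel`). This is `sublevel_comparison`. Equimeasurability of `f` and `f^*`
bounds the two penalties by the rearrangement terms of the theorem. Integrating over `s` gives `τ I
≤ B + τ ∬ (F(energy) - F(energy + τ))`, where `B` is the bracket (`lintegral_comparison`).

The analytic point is that the last integral is at most `W τ` (`decrementBound_univ`). Away from the
critical points of the energy, shells of width `τ` have area `O(τ)`. Near a critical point whose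
value is not `e_*`, the profile is Lipschitz. At the saddle, when `e_* = m₀`, shells lose a
logarithm, which the logarithmic hypothesis absorbs. Optimizing `τ I ≤ B + W τ²` in `τ` yields `I² ≤
4 W B`. -/

namespace HMF

/-! ### Layer-cake formulas. -/

theorem volume_between_levels (a b : ℝ≥0∞) :
    volume {s : ℝ | 0 < s ∧ b ≤ ENNReal.ofReal s ∧ ENNReal.ofReal s < a} = a - b := by
  rcases le_or_gt a b with hab | hab
  · rw [tsub_eq_zero_of_le hab]
    convert measure_empty (μ := volume)
    ext s
    simp only [mem_ofPred_eq, mem_empty_iff_false, iff_false, not_and, not_lt]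
    exact fun _ h => hab.trans h
  have hb : b ≠ ⊤ := hab.ne_top
  lift b to NNReal using hb
  rcases eq_or_ne a ⊤ with rfl | ha
  · rw [ENNReal.top_sub ENNReal.coe_ne_top]
    refine measure_mono_top (s₁ := Ioi (b : ℝ)) (fun s hs => ?_) Real.volume_Ioi
    have hs' : (b : ℝ) < s := hs
    refine ⟨b.coe_nonneg.trans_lt hs', ?_, ENNReal.ofReal_lt_top⟩
    rw [← ENNReal.ofReal_coe_nnreal]
    exact ENNReal.ofReal_le_ofReal hs'.le
  lift a to NNReal using ha
  have key : ∀ s : ℝ, 0 < s → (((b : ℝ≥0∞) ≤ ENNReal.ofReal s ∧ ENNReal.ofReal s < (a : ℝ≥0∞)) ↔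
      ((b : ℝ) ≤ s ∧ s < a)) := by
    intro s hs
    rw [← ENNReal.ofReal_coe_nnreal, ← ENNReal.ofReal_coe_nnreal,
      ENNReal.ofReal_le_ofReal_iff hs.le, ENNReal.ofReal_lt_ofReal_iff_of_nonneg hs.le]
  have hval : (a : ℝ≥0∞) - b = ENNReal.ofReal ((a : ℝ) - b) := by
    rw [ENNReal.ofReal_sub _ b.coe_nonneg, ENNReal.ofReal_coe_nnreal, ENNReal.ofReal_coe_nnreal]
  rw [hval]
  apply le_antisymm
  · rw [← Real.volume_Ico]
    exact measure_mono fun s hs => (key s hs.1).1 hs.2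
  · rw [← Real.volume_Ioo]
    refine measure_mono fun s hs => ?_
    have h0 : 0 < s := b.coe_nonneg.trans_lt hs.1
    exact ⟨h0, (key s h0).2 ⟨hs.1.le, hs.2⟩⟩

theorem measurableSet_between_levels {α : Type*} [MeasurableSpace α] {g h : α → ℝ≥0∞}
    (hg : Measurable g) (hh : Measurable h) :
    MeasurableSet {q : α × ℝ | h q.1 ≤ ENNReal.ofReal q.2 ∧ ENNReal.ofReal q.2 < g q.1} :=
  (measurableSet_le (hh.comp measurable_fst) (ENNReal.measurable_ofReal.comp measurable_snd)).inter
    (measurableSet_lt (ENNReal.measurable_ofReal.comp measurable_snd) (hg.comp measurable_fst))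

theorem measurable_measure_between_levels {α : Type*} [MeasurableSpace α] (μ : Measure α)
    [SFinite μ] {g h : α → ℝ≥0∞} (hg : Measurable g) (hh : Measurable h) :
    Measurable fun s : ℝ => μ {p | h p ≤ ENNReal.ofReal s ∧ ENNReal.ofReal s < g p} :=
  measurable_measure_prodMk_right (measurableSet_between_levels hg hh)

/-- Layer-cake formula for the truncated difference of two functions. -/
theorem lintegral_tsub_eq_lintegral_levels {α : Type*} [MeasurableSpace α] (μ : Measure α)
    [SFinite μ] {g h : α → ℝ≥0∞} (hg : Measurable g) (hh : Measurable h) :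
    ∫⁻ p, (g p - h p) ∂μ =
      ∫⁻ s in Ioi (0 : ℝ), μ {p | h p ≤ ENNReal.ofReal s ∧ ENNReal.ofReal s < g p} := by
  have hS := measurableSet_between_levels hg hh
  have h1 := Measure.prod_apply (μ := μ) (ν := volume.restrict (Ioi (0 : ℝ))) hS
  have h2 := Measure.prod_apply_symm (μ := μ) (ν := volume.restrict (Ioi (0 : ℝ))) hS
  rw [h1] at h2
  calc ∫⁻ p, (g p - h p) ∂μ = _ := ?_
    _ = _ := h2
    _ = _ := rfl
  refine lintegral_congr fun p => ?_
  rw [Measure.restrict_apply (measurable_prodMk_left hS), ← volume_between_levels]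
  congr 1
  ext s
  simp only [mem_ofPred_eq, mem_inter_iff, mem_preimage, mem_Ioi]
  tauto

theorem lintegral_eq_lintegral_levels {α : Type*} [MeasurableSpace α] (μ : Measure α)
    [SFinite μ] {g : α → ℝ≥0∞} (hg : Measurable g) :
    ∫⁻ p, g p ∂μ = ∫⁻ s in Ioi (0 : ℝ), μ {p | ENNReal.ofReal s < g p} := by
  simpa using lintegral_tsub_eq_lintegral_levels μ hg (h := fun _ => 0) measurable_const

theorem measurable_measure_lt {α : Type*} [MeasurableSpace α] (μ : Measure α) (f : α → ℝ) :
    Measurable fun s : ℝ => μ {p | s < f p} :=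
  Antitone.measurable fun _ _ hst => measure_mono fun _ hp => lt_of_le_of_lt hst hp

theorem lintegral_ofReal_eq_lintegral_levels {α : Type*} [MeasurableSpace α] (μ : Measure α)
    [SFinite μ] {g : α → ℝ} (hg : Measurable g) :
    ∫⁻ p, ENNReal.ofReal (g p) ∂μ = ∫⁻ s in Ioi (0 : ℝ), μ {p | s < g p} := by
  rw [lintegral_eq_lintegral_levels μ hg.ennreal_ofReal]
  refine setLIntegral_congr_fun measurableSet_Ioi fun s hs => ?_
  simp only [ENNReal.ofReal_lt_ofReal_iff_of_nonneg (le_of_lt hs)]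

theorem lintegral_ofReal_tsub_eq_lintegral_levels {α : Type*} [MeasurableSpace α] (μ : Measure α)
    [SFinite μ] {g h : α → ℝ} (hg : Measurable g) (hh : Measurable h) :
    ∫⁻ p, (ENNReal.ofReal (g p) - ENNReal.ofReal (h p)) ∂μ =
      ∫⁻ s in Ioi (0 : ℝ), μ {p | h p ≤ s ∧ s < g p} := by
  rw [lintegral_tsub_eq_lintegral_levels μ hg.ennreal_ofReal hh.ennreal_ofReal]
  refine setLIntegral_congr_fun measurableSet_Ioi fun s hs => ?_
  have hs0 : (0 : ℝ) ≤ s := le_of_lt hs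
  simp only [ENNReal.ofReal_le_ofReal_iff hs0, ENNReal.ofReal_lt_ofReal_iff_of_nonneg hs0]

theorem measurable_measure_le_and_lt {α : Type*} [MeasurableSpace α] (μ : Measure α) [SFinite μ]
    {g h : α → ℝ} (hg : Measurable g) (hh : Measurable h) :
    Measurable fun s : ℝ => μ {p | h p ≤ s ∧ s < g p} :=
  measurable_measure_prodMk_right (s := {q : α × ℝ | h q.1 ≤ q.2 ∧ q.2 < g q.1})
    ((measurableSet_le (hh.comp measurable_fst) measurable_snd).inter
      (measurableSet_lt measurable_snd (hg.comp measurable_fst)))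

/-! ### Distribution functions, rearrangements and equimeasurability. -/

instance : SFinite phase := by unfold phase; infer_instance

theorem phase_univ : phase univ = ⊤ := by
  rw [phase, ← univ_prod_univ, Measure.prod_prod]
  simp [ENNReal.mul_top, Real.pi_pos]

theorem distrib_antitone (f : ℝ × ℝ → ℝ) : Antitone (distrib f) :=
  fun _ _ hst => measure_mono fun _ hp => lt_of_le_of_lt hst hp

/-- Right-continuity of `distrib f`, from continuity of the measure along the increasing sets `{f >
u n}` with `u n ↓ s`. It makes the equivalence in `ofReal_lt_sharp_iff` exact, with strict
inequalities on both sides. -/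
theorem exists_gt_lt_distrib {f : ℝ × ℝ → ℝ} {s : ℝ} {m : ℝ≥0∞} (hm : m < distrib f s) :
    ∃ t, s < t ∧ m < distrib f t := by
  obtain ⟨u, hu, hus, hul⟩ := exists_seq_strictAnti_tendsto s
  have hU : {p | s < f p} = ⋃ n, {p | u n < f p} := by
    ext p
    simp only [mem_ofPred_eq, mem_iUnion]
    refine ⟨fun hp => (hul.eventually (gt_mem_nhds hp)).exists, fun ⟨n, hn⟩ => (hus n).trans hn⟩
  have hmono : Monotone fun n => {p | u n < f p} :=
    fun i j hij p hp => lt_of_le_of_lt (hu.antitone hij) hp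
  rw [distrib, hU, hmono.measure_iUnion, lt_iSup_iff] at hm
  obtain ⟨n, hn⟩ := hm
  exact ⟨u n, hus n, hn⟩

theorem ofReal_lt_sharp_iff {f : ℝ × ℝ → ℝ} {s : ℝ} (hs : 0 ≤ s) (m : ℝ≥0∞) :
    ENNReal.ofReal s < sharp f m ↔ m < distrib f s := by
  constructor
  · intro h
    by_contra! hc
    exact absurd (iInf₂_le s ⟨hs, hc⟩) (not_le.2 h)
  · intro h
    obtain ⟨t, hst, ht⟩ := exists_gt_lt_distrib h
    refine lt_of_lt_of_le ((ENNReal.ofReal_lt_ofReal_iff_of_nonneg hs).2 hst)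
      (le_iInf₂ fun r hr => ENNReal.ofReal_le_ofReal ?_)
    by_contra! hc
    exact absurd (ht.trans_le (distrib_antitone f hc.le)) (not_lt.2 hr.2)

theorem sharp_antitone (f : ℝ × ℝ → ℝ) : Antitone (sharp f) :=
  fun _ _ hmn => le_iInf₂ fun t ht => iInf₂_le t ⟨ht.1, ht.2.trans hmn⟩

/-- The area of the part of the disc of squared radius `r` that lies in the strip. -/
noncomputable def discArea (r : ℝ) : ℝ≥0∞ := phase {q : ℝ × ℝ | q.1 ^ 2 + q.2 ^ 2 < r}

theorem discArea_mono : Monotone discArea :=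
  fun _ _ h => measure_mono fun _ hq => lt_of_lt_of_le hq h

theorem measurable_rearr (f : ℝ × ℝ → ℝ) : Measurable (rearr f) := by
  have h1 : Measurable fun p : ℝ × ℝ => p.1 ^ 2 + p.2 ^ 2 := by fun_prop
  exact (sharp_antitone f).measurable.comp (discArea_mono.measurable.comp h1)

theorem discArea_lt_top (r : ℝ) : discArea r < ⊤ := by
  refine lt_of_le_of_lt (measure_mono (t := univ ×ˢ Ioo (-(|r| + 1)) (|r| + 1)) ?_) ?_
  · rintro ⟨x, v⟩ h
    simp only [mem_ofPred_eq] at h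
    refine ⟨mem_univ _, abs_lt.1 (abs_lt_of_sq_lt_sq ?_ (by positivity))⟩
    nlinarith [le_abs_self r, abs_nonneg r, sq_nonneg x]
  · rw [phase, Measure.prod_prod]
    simp [ENNReal.mul_lt_top_iff]

theorem phase_circle (r : ℝ) : phase {q : ℝ × ℝ | q.1 ^ 2 + q.2 ^ 2 = r} = 0 := by
  have hm : MeasurableSet {q : ℝ × ℝ | q.1 ^ 2 + q.2 ^ 2 = r} :=
    measurableSet_eq_fun (by fun_prop) (by fun_prop)
  rw [phase, Measure.measure_prod_null hm]
  refine ae_of_all _ fun x => ?_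
  refine (Set.Finite.subset (Set.toFinite {√(r - x ^ 2), -√(r - x ^ 2)}) ?_).measure_zero _
  intro v hv
  have hv' : x ^ 2 + v ^ 2 = r := hv
  have : √(r - x ^ 2) = |v| := by rw [← Real.sqrt_sq_eq_abs]; congr 1; linarith
  simp only [mem_insert_iff, mem_singleton_iff, this]
  rcases abs_choice v with h | h <;> rw [h] <;> simp

/-- With `R` the supremum of the squared radii whose disc has area below `m`, the set lies between
the open and the closed disc of squared radius `R`. Approximation from inside and from outside shows
that these have area `≤ m` and `≥ m`, and circles are null. `R` is finite because phase space has
infinite measure. -/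
theorem phase_discArea_lt {m : ℝ≥0∞} (hm : m ≠ ⊤) :
    phase {p : ℝ × ℝ | discArea (p.1 ^ 2 + p.2 ^ 2) < m} = m := by
  rcases eq_or_ne m 0 with rfl | hm0
  · simp
  let S : Set ℝ := {r | discArea r < m}
  have hS0 : (0 : ℝ) ∈ S := by
    have : discArea 0 = 0 := by
      rw [discArea]; convert measure_empty (μ := phase); ext q
      simp only [mem_ofPred_eq, mem_empty_iff_false, iff_false, not_lt]; positivity
    simpa [S, this] using hm0.bot_lt
  have hbdd : BddAbove S := by
    by_contra hnb
    have hall : ∀ r, discArea r < m := by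
      intro r
      obtain ⟨t, ht, hrt⟩ := not_bddAbove_iff.1 hnb r
      exact lt_of_le_of_lt (discArea_mono hrt.le) ht
    have hU : (univ : Set (ℝ × ℝ)) = ⋃ n : ℕ, {q : ℝ × ℝ | q.1 ^ 2 + q.2 ^ 2 < n} := by
      ext q; simpa using exists_nat_gt (q.1 ^ 2 + q.2 ^ 2)
    have hmono : Monotone fun n : ℕ => {q : ℝ × ℝ | q.1 ^ 2 + q.2 ^ 2 < n} :=
      fun i j hij q (hq : q.1 ^ 2 + q.2 ^ 2 < i) => hq.trans_le (Nat.cast_le.2 hij)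
    have := phase_univ
    rw [hU, hmono.measure_iUnion] at this
    exact hm (top_le_iff.1 (this ▸ iSup_le fun n => (hall n).le))
  set R := sSup S with hR
  have hle : discArea R ≤ m := by
    obtain ⟨u, hu, huR, hul⟩ := exists_seq_strictMono_tendsto R
    have hU : {q : ℝ × ℝ | q.1 ^ 2 + q.2 ^ 2 < R} = ⋃ n, {q : ℝ × ℝ | q.1 ^ 2 + q.2 ^ 2 < u n} := by
      ext q
      simp only [mem_ofPred_eq, mem_iUnion]
      exact ⟨fun hp => (hul.eventually (lt_mem_nhds hp)).exists, fun ⟨n, hn⟩ => hn.trans (huR n)⟩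
    have hmono : Monotone fun n => {q : ℝ × ℝ | q.1 ^ 2 + q.2 ^ 2 < u n} :=
      fun i j hij q hq => lt_of_lt_of_le hq (hu.monotone hij)
    rw [discArea, hU, hmono.measure_iUnion]
    refine iSup_le fun n => ?_
    obtain ⟨t, ht, hut⟩ := exists_lt_of_lt_csSup ⟨0, hS0⟩ (huR n)
    exact (discArea_mono hut.le).trans (le_of_lt ht)
  have hge : m ≤ phase {q : ℝ × ℝ | q.1 ^ 2 + q.2 ^ 2 ≤ R} := by
    obtain ⟨u, hu, huR, hul⟩ := exists_seq_strictAnti_tendsto R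
    have hI : {q : ℝ × ℝ | q.1 ^ 2 + q.2 ^ 2 ≤ R} = ⋂ n, {q : ℝ × ℝ | q.1 ^ 2 + q.2 ^ 2 < u n} := by
      ext q
      simp only [mem_ofPred_eq, mem_iInter]
      exact ⟨fun hp n => lt_of_le_of_lt hp (huR n), fun h => ge_of_tendsto' hul fun n => (h n).le⟩
    have hanti : Antitone fun n => {q : ℝ × ℝ | q.1 ^ 2 + q.2 ^ 2 < u n} :=
      fun i j hij q hq => lt_of_lt_of_le hq (hu.antitone hij)
    rw [hI, hanti.measure_iInter
      (fun n => (measurableSet_lt (by fun_prop) (by fun_prop)).nullMeasurableSet)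
      ⟨0, (discArea_lt_top _).ne⟩]
    refine le_iInf fun n => ?_
    by_contra! hc
    exact absurd (le_csSup hbdd (show u n ∈ S from hc)) (not_le.2 (huR n))
  have heq : phase {q : ℝ × ℝ | q.1 ^ 2 + q.2 ^ 2 ≤ R} ≤ discArea R := by
    calc phase {q : ℝ × ℝ | q.1 ^ 2 + q.2 ^ 2 ≤ R}
        ≤ phase ({q : ℝ × ℝ | q.1 ^ 2 + q.2 ^ 2 < R} ∪ {q : ℝ × ℝ | q.1 ^ 2 + q.2 ^ 2 = R}) :=
          measure_mono fun q (hq : q.1 ^ 2 + q.2 ^ 2 ≤ R) => lt_or_eq_of_le hq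
      _ ≤ discArea R + 0 := (measure_union_le _ _).trans (by rw [phase_circle, discArea])
      _ = discArea R := add_zero _
  apply le_antisymm
  · refine le_trans (measure_mono fun p hp => ?_) (heq.trans hle)
    exact le_csSup hbdd (show p.1 ^ 2 + p.2 ^ 2 ∈ S from hp)
  · refine (hge.trans heq).trans (measure_mono fun p hp => ?_)
    obtain ⟨t, ht, hut⟩ := exists_lt_of_lt_csSup ⟨0, hS0⟩ (show p.1 ^ 2 + p.2 ^ 2 < R from hp)
    exact lt_of_le_of_lt (discArea_mono hut.le) ht

/-- `f` and `f^*` are equimeasurable. -/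
theorem phase_ofReal_lt_rearr {f : ℝ × ℝ → ℝ} {s : ℝ} (hs : 0 ≤ s) (hfin : distrib f s ≠ ⊤) :
    phase {p | ENNReal.ofReal s < rearr f p} = distrib f s := by
  rw [← phase_discArea_lt hfin]
  congr 1
  ext p
  exact ofReal_lt_sharp_iff hs _

theorem distrib_eq_ofReal {f : ℝ × ℝ → ℝ} {s : ℝ} (hs : 0 ≤ s) :
    distrib f s = phase {p | ENNReal.ofReal s < ENNReal.ofReal (f p)} := by
  simp only [ENNReal.ofReal_lt_ofReal_iff_of_nonneg hs]
  rfl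

theorem distrib_ne_top {f : ℝ × ℝ → ℝ} (hf : Measurable f)
    (hfin : ∫⁻ p, ENNReal.ofReal (f p) ∂phase ≠ ⊤) {s : ℝ} (hs : 0 < s) : distrib f s ≠ ⊤ := by
  rw [distrib_eq_ofReal hs.le]
  refine ((measure_mono (t := {p | ENNReal.ofReal s ≤ ENNReal.ofReal (f p)})
    fun p hp => le_of_lt (Set.mem_ofPred_eq ▸ hp)).trans_lt ((meas_ge_le_lintegral_div hf.ennreal_ofReal.aemeasurable
      (ENNReal.ofReal_pos.2 hs).ne' ENNReal.ofReal_ne_top).trans_lt ?_)).ne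
  exact ENNReal.div_lt_top hfin (ENNReal.ofReal_pos.2 hs).ne'

theorem lintegral_rearr {f : ℝ × ℝ → ℝ} (hf : Measurable f)
    (hfin : ∫⁻ p, ENNReal.ofReal (f p) ∂phase ≠ ⊤) :
    ∫⁻ p, rearr f p ∂phase = ∫⁻ p, ENNReal.ofReal (f p) ∂phase := by
  rw [lintegral_eq_lintegral_levels phase (measurable_rearr f),
    lintegral_ofReal_eq_lintegral_levels phase hf]
  exact setLIntegral_congr_fun measurableSet_Ioi fun s hs =>
    phase_ofReal_lt_rearr (le_of_lt hs) (distrib_ne_top hf hfin hs)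

theorem distL1_rearr_lt_top {f g : ℝ × ℝ → ℝ} (hf : Measurable f) (hg : Measurable g)
    (hff : ∫⁻ p, ENNReal.ofReal (f p) ∂phase ≠ ⊤) (hgf : ∫⁻ p, ENNReal.ofReal (g p) ∂phase ≠ ⊤) :
    distL1 (rearr f) (rearr g) < ⊤ := by
  calc distL1 (rearr f) (rearr g) ≤ ∫⁻ p, (rearr f p + rearr g p) ∂phase :=
        lintegral_mono fun p => add_le_add tsub_le_self tsub_le_self
    _ = ∫⁻ p, ENNReal.ofReal (f p) ∂phase + ∫⁻ p, ENNReal.ofReal (g p) ∂phase := by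
        rw [lintegral_add_left (measurable_rearr f), lintegral_rearr hf hff, lintegral_rearr hg hgf]
    _ < ⊤ := ENNReal.add_lt_top.2 ⟨hff.lt_top, hgf.lt_top⟩

/-- Rearranging preserves the measures of the super-level sets, and a difference of measures is at
most the measure of the set difference. -/
theorem tsub_distrib_le_beta_rearr {f g : ℝ × ℝ → ℝ} {s : ℝ} (hs : 0 ≤ s)
    (hf : distrib f s ≠ ⊤) (hg : distrib g s ≠ ⊤) :
    distrib g s - distrib f s ≤ beta (rearr f) (rearr g) s := by
  rw [← phase_ofReal_lt_rearr hs hf, ← phase_ofReal_lt_rearr hs hg]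
  refine le_measure_sdiff.trans (measure_mono fun p hp => ?_)
  exact ⟨not_lt.1 hp.2, hp.1⟩

theorem lintegral_tsub_distrib_le_distL1 {f g : ℝ × ℝ → ℝ} (hf : Measurable f) (hg : Measurable g)
    (hff : ∫⁻ p, ENNReal.ofReal (f p) ∂phase ≠ ⊤) (hgf : ∫⁻ p, ENNReal.ofReal (g p) ∂phase ≠ ⊤) :
    ∫⁻ s in Ioi (0 : ℝ), ((distrib f s - distrib g s) + (distrib g s - distrib f s)) ≤
      distL1 (rearr f) (rearr g) := by
  have hm : Measurable fun p => rearr f p - rearr g p :=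
    (measurable_rearr f).sub (measurable_rearr g)
  rw [distL1, lintegral_add_left hm,
    lintegral_tsub_eq_lintegral_levels phase (measurable_rearr f) (measurable_rearr g),
    lintegral_tsub_eq_lintegral_levels phase (measurable_rearr g) (measurable_rearr f),
    ← lintegral_add_left (measurable_measure_between_levels phase (measurable_rearr f)
      (measurable_rearr g))]
  refine setLIntegral_mono' measurableSet_Ioi fun s hs => ?_
  have hs0 : 0 < s := hs
  have h1 := distrib_ne_top hf hff hs0
  have h2 := distrib_ne_top hg hgf hs0
  exact add_le_add (tsub_distrib_le_beta_rearr hs0.le h2 h1)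
    (tsub_distrib_le_beta_rearr hs0.le h1 h2)

end HMF

/-! ### Area of thin energy shells. -/

namespace HMF

theorem volume_le_of_abs_sub_le {S : Set ℝ} {d : ℝ} (h : ∀ x ∈ S, ∀ y ∈ S, |x - y| ≤ d) :
    volume S ≤ ENNReal.ofReal d := by
  refine (Real.volume_le_diam S).trans (Metric.ediam_le fun x hx y hy => ?_)
  rw [edist_dist, Real.dist_eq]
  exact ENNReal.ofReal_le_ofReal (h x hx y hy)

/-- In a velocity slice away from `v = 0`, an energy shell of width `τ` has length `O(τ)`. -/
theorem volume_velocity_slice_le {κ : ℝ} (hκ : 0 < κ) (τ c φ : ℝ) :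
    volume {v : ℝ | κ ≤ |v| ∧ c - τ ≤ v ^ 2 / 2 + φ ∧ v ^ 2 / 2 + φ < c} ≤
      ENNReal.ofReal (τ / κ) + ENNReal.ofReal (τ / κ) := by
  have key : ∀ v w : ℝ, κ ≤ v → κ ≤ w → |v ^ 2 / 2 - w ^ 2 / 2| ≤ τ → |v - w| ≤ τ / κ := by
    intro v w hv hw h
    rw [le_div_iff₀ hκ]
    have : v ^ 2 / 2 - w ^ 2 / 2 = (v - w) * ((v + w) / 2) := by ring
    rw [this, abs_mul, abs_of_pos (by linarith : 0 < (v + w) / 2)] at h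
    exact le_trans (mul_le_mul_of_nonneg_left (by linarith) (abs_nonneg _)) h
  refine le_trans (measure_mono (t := {v : ℝ | κ ≤ v ∧ c - τ ≤ v ^ 2 / 2 + φ ∧ v ^ 2 / 2 + φ < c} ∪
    {v : ℝ | κ ≤ -v ∧ c - τ ≤ v ^ 2 / 2 + φ ∧ v ^ 2 / 2 + φ < c}) ?_)
    ((measure_union_le _ _).trans (add_le_add ?_ ?_))
  · intro v hv
    exact (le_abs.1 hv.1).imp (fun h => ⟨h, hv.2⟩) (fun h => ⟨h, hv.2⟩)
  · refine volume_le_of_abs_sub_le fun v hv w hw => key v w hv.1 hw.1 ?_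
    rw [abs_le]
    constructor <;> linarith [hv.2.1, hv.2.2, hw.2.1, hw.2.2]
  · refine volume_le_of_abs_sub_le fun v hv w hw => ?_
    have := key (-v) (-w) hv.1 hw.1 (by
      rw [neg_sq, neg_sq, abs_le]
      constructor <;> linarith [hv.2.1, hv.2.2, hw.2.1, hw.2.2])
    rwa [neg_sub_neg, abs_sub_comm] at this

/-- Write the difference of cosines as a product of sines at the midpoint and at the
half-difference. The first is at least `κ` because `sin x + sin y = 2 sin ((x + y) / 2) cos ((x - y)
/ 2)`, and the second is bounded below by Jordan's inequality. -/
theorem abs_sub_le_of_le_sin {κ x y : ℝ} (hκ : 0 < κ) (hx : x ∈ Icc 0 Real.pi)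
    (hy : y ∈ Icc 0 Real.pi) (hsx : κ ≤ Real.sin x) (hsy : κ ≤ Real.sin y) :
    |x - y| * (2 * κ / Real.pi) ≤ |Real.cos x - Real.cos y| := by
  wlog hyx : y ≤ x generalizing x y
  · rw [abs_sub_comm, abs_sub_comm (Real.cos x)]
    exact this hy hx hsy hsx (le_of_not_ge hyx)
  have hpi := Real.pi_pos
  have h1 : κ ≤ Real.sin ((x + y) / 2) := by
    have e1 : Real.sin x = Real.sin ((x + y) / 2 + (x - y) / 2) := by ring_nf
    have e2 : Real.sin y = Real.sin ((x + y) / 2 - (x - y) / 2) := by ring_nf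
    rw [e1, Real.sin_add] at hsx
    rw [e2, Real.sin_sub] at hsy
    have h0 : 0 ≤ Real.sin ((x + y) / 2) :=
      Real.sin_nonneg_of_nonneg_of_le_pi (by linarith [hx.1, hy.1]) (by linarith [hx.2, hy.2])
    nlinarith [Real.cos_le_one ((x - y) / 2)]
  have h2 : 2 / Real.pi * ((x - y) / 2) ≤ Real.sin ((x - y) / 2) :=
    Real.mul_le_sin (by linarith) (by linarith [hx.2, hy.1])
  have h3 : 0 ≤ 2 / Real.pi * ((x - y) / 2) := by
    have : 0 ≤ x - y := by linarith
    positivity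
  rw [Real.cos_sub_cos, abs_of_nonneg (by linarith : 0 ≤ x - y), mul_assoc (-2), abs_mul,
    abs_of_nonneg (mul_nonneg (hκ.le.trans h1) (h3.trans h2))]
  have h4 := mul_le_mul h1 h2 h3 (hκ.le.trans h1)
  have h5 : (x - y) * (2 * κ / Real.pi) = 2 * (κ * (2 / Real.pi * ((x - y) / 2))) := by
    field_simp
  rw [h5, show |(-2 : ℝ)| = 2 by norm_num]
  linarith

/-- In an angular slice away from the zeros of `sin`, an energy shell of width `τ` has length
`O(τ)`. -/
theorem volume_angle_slice_le {κ m₀ : ℝ} (hκ : 0 < κ) (hm : 0 < m₀) (τ c w : ℝ) :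
    (volume.restrict (Ico (0 : ℝ) (2 * Real.pi)))
      {θ : ℝ | κ ≤ |Real.sin θ| ∧ c - τ ≤ w + -m₀ * Real.cos θ ∧ w + -m₀ * Real.cos θ < c} ≤
      ENNReal.ofReal (Real.pi * τ / (2 * κ * m₀)) + ENNReal.ofReal (Real.pi * τ / (2 * κ * m₀)) := by
  have hpi := Real.pi_pos
  have key : ∀ x y : ℝ, x ∈ Icc 0 Real.pi → y ∈ Icc 0 Real.pi → κ ≤ Real.sin x → κ ≤ Real.sin y →
      m₀ * |Real.cos x - Real.cos y| ≤ τ → |x - y| ≤ Real.pi * τ / (2 * κ * m₀) := by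
    intro x y hx hy hsx hsy h
    have h1 := abs_sub_le_of_le_sin hκ hx hy hsx hsy
    rw [le_div_iff₀ (by positivity)]
    calc |x - y| * (2 * κ * m₀) = Real.pi * (m₀ * (|x - y| * (2 * κ / Real.pi))) := by
          field_simp
      _ ≤ Real.pi * (m₀ * |Real.cos x - Real.cos y|) := by gcongr
      _ ≤ Real.pi * τ := by gcongr
  have hshell : ∀ x y : ℝ, c - τ ≤ w + -m₀ * Real.cos x → w + -m₀ * Real.cos x < c →
      c - τ ≤ w + -m₀ * Real.cos y → w + -m₀ * Real.cos y < c →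
      m₀ * |Real.cos x - Real.cos y| ≤ τ := by
    intro x y h1 h2 h3 h4
    have h5 : m₀ * |Real.cos x - Real.cos y| = |m₀ * (Real.cos x - Real.cos y)| := by
      rw [abs_mul, abs_of_pos hm]
    rw [h5, abs_le]
    constructor <;> linarith
  rw [Measure.restrict_apply' measurableSet_Ico]
  set A := {θ : ℝ | κ ≤ |Real.sin θ| ∧ c - τ ≤ w + -m₀ * Real.cos θ ∧ w + -m₀ * Real.cos θ < c}
  -- The cosine is injective on each half of the circle. The second half is reduced to the first by
  -- a shift of `π`.
  refine le_trans (measure_mono (t := (A ∩ Icc 0 Real.pi) ∪ (A ∩ Icc Real.pi (2 * Real.pi))) ?_)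
    ((measure_union_le _ _).trans (add_le_add ?_ ?_))
  · intro x hx
    rcases le_total x Real.pi with h | h
    · exact Or.inl ⟨hx.1, hx.2.1, h⟩
    · exact Or.inr ⟨hx.1, h, hx.2.2.le⟩
  · refine volume_le_of_abs_sub_le fun x hx y hy => key x y hx.2 hy.2 ?_ ?_
      (hshell x y hx.1.2.1 hx.1.2.2 hy.1.2.1 hy.1.2.2)
    · rw [← abs_of_nonneg (Real.sin_nonneg_of_mem_Icc hx.2)]; exact hx.1.1
    · rw [← abs_of_nonneg (Real.sin_nonneg_of_mem_Icc hy.2)]; exact hy.1.1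
  · have hsh : ∀ x ∈ A ∩ Icc Real.pi (2 * Real.pi),
        x - Real.pi ∈ Icc 0 Real.pi ∧ κ ≤ Real.sin (x - Real.pi) := by
      intro x hx
      have h1 : x - Real.pi ∈ Icc 0 Real.pi := ⟨by linarith [hx.2.1], by linarith [hx.2.2]⟩
      refine ⟨h1, ?_⟩
      rw [← abs_of_nonneg (Real.sin_nonneg_of_mem_Icc h1), Real.sin_sub_pi, abs_neg]
      exact hx.1.1
    refine volume_le_of_abs_sub_le fun x hx y hy => ?_
    have h3 := hshell x y hx.1.2.1 hx.1.2.2 hy.1.2.1 hy.1.2.2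
    have := key _ _ (hsh x hx).1 (hsh y hy).1 (hsh x hx).2 (hsh y hy).2 (by
      rwa [Real.cos_sub_pi, Real.cos_sub_pi, neg_sub_neg, abs_sub_comm])
    rwa [sub_sub_sub_cancel_right] at this

/-- The microscopic energy in the potential `-m₀ cos θ`. -/
noncomputable def energy (m₀ : ℝ) (p : ℝ × ℝ) : ℝ := p.2 ^ 2 / 2 + -m₀ * Real.cos p.1

theorem continuous_energy (m₀ : ℝ) : Continuous (energy m₀) := by
  unfold energy; fun_prop

theorem neg_le_energy {m₀ : ℝ} (hm : 0 < m₀) (p : ℝ × ℝ) : -m₀ ≤ energy m₀ p := by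
  have := Real.cos_le_one p.1
  unfold energy
  nlinarith [sq_nonneg p.2]

theorem measurableSet_shell (m₀ a b : ℝ) :
    MeasurableSet {p : ℝ × ℝ | a ≤ energy m₀ p ∧ energy m₀ p < b} :=
  (measurableSet_le measurable_const (continuous_energy m₀).measurable).inter
    (measurableSet_lt (continuous_energy m₀).measurable measurable_const)

theorem phase_shell_large_velocity_le (m₀ : ℝ) {κ : ℝ} (hκ : 0 < κ) {τ : ℝ} (hτ : 0 ≤ τ) (c : ℝ) :
    (phase.restrict {p | κ ≤ |p.2|}) {p | c - τ ≤ energy m₀ p ∧ energy m₀ p < c} ≤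
      ENNReal.ofReal (4 * Real.pi / κ) * ENNReal.ofReal τ := by
  have hR : MeasurableSet {p : ℝ × ℝ | κ ≤ |p.2|} := measurableSet_le (by fun_prop) (by fun_prop)
  have hS := measurableSet_shell m₀ (c - τ) c
  rw [Measure.restrict_apply hS, phase, Measure.prod_apply (hS.inter hR)]
  calc _ ≤ ∫⁻ _ in Ico (0 : ℝ) (2 * Real.pi), (ENNReal.ofReal (τ / κ) + ENNReal.ofReal (τ / κ)) :=
        lintegral_mono fun θ => (volume_velocity_slice_le hκ τ c (-m₀ * Real.cos θ)).trans'
          (measure_mono fun v hv => ⟨hv.2, hv.1⟩)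
    _ = _ := by
        have := Real.pi_pos
        rw [lintegral_const, Measure.restrict_apply_univ, Real.volume_Ico,
          ← ENNReal.ofReal_add (by positivity) (by positivity),
          ← ENNReal.ofReal_mul (by positivity), ← ENNReal.ofReal_mul (by positivity)]
        congr 1
        ring

/-- Here the slices are taken at fixed velocity. The factor `1 / κ` of each slice is cancelled by
the width `2κ` of the velocity range. -/
theorem phase_shell_large_sin_le {m₀ : ℝ} (hm : 0 < m₀) {κ : ℝ} (hκ : 0 < κ) {τ : ℝ} (hτ : 0 ≤ τ)
    (c : ℝ) :
    (phase.restrict {p | |p.2| < κ ∧ κ ≤ |Real.sin p.1|})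
      {p | c - τ ≤ energy m₀ p ∧ energy m₀ p < c} ≤
      ENNReal.ofReal (2 * Real.pi / m₀) * ENNReal.ofReal τ := by
  have hR : MeasurableSet {p : ℝ × ℝ | |p.2| < κ ∧ κ ≤ |Real.sin p.1|} :=
    (measurableSet_lt (f := fun p : ℝ × ℝ => |p.2|) (by fun_prop) measurable_const).inter
      (measurableSet_le (g := fun p : ℝ × ℝ => |Real.sin p.1|) measurable_const (by fun_prop))
  have hS := measurableSet_shell m₀ (c - τ) c
  have hpi := Real.pi_pos
  rw [Measure.restrict_apply hS, phase, Measure.prod_apply_symm (hS.inter hR)]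
  calc _ ≤ ∫⁻ v, (Ioo (-κ) κ).indicator (fun _ => ENNReal.ofReal (Real.pi * τ / (2 * κ * m₀)) +
          ENNReal.ofReal (Real.pi * τ / (2 * κ * m₀))) v := by
        refine lintegral_mono fun v => ?_
        by_cases hv : v ∈ Ioo (-κ) κ
        · rw [indicator_of_mem hv]
          exact (volume_angle_slice_le hκ hm τ c (v ^ 2 / 2)).trans'
            (measure_mono fun θ hθ => ⟨hθ.2.2, hθ.1⟩)
        · rw [indicator_of_notMem hv]
          refine le_of_eq ?_
          convert measure_empty (μ := volume.restrict (Ico (0 : ℝ) (2 * Real.pi)))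
          ext θ
          simp only [mem_preimage, mem_inter_iff, mem_ofPred_eq, mem_empty_iff_false, iff_false]
          exact fun h => hv (abs_lt.1 h.2.1)
    _ = _ := by
        rw [lintegral_indicator measurableSet_Ioo, lintegral_const, Measure.restrict_apply_univ,
          Real.volume_Ioo, ← ENNReal.ofReal_add (by positivity) (by positivity),
          ← ENNReal.ofReal_mul (by positivity), ← ENNReal.ofReal_mul (by positivity)]
        congr 1
        field_simp
        ring

theorem lintegral_inv_add_abs_le {a : ℝ} (ha : 0 < a) :
    ∫⁻ v in Ioo (-1 : ℝ) 1, ENNReal.ofReal (1 / (a + |v|)) ≤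
      ENNReal.ofReal (2 * Real.log ((a + 1) / a)) := by
  have hc : Continuous fun v : ℝ => 1 / (a + |v|) :=
    continuous_const.div (by fun_prop) fun v => by positivity
  have hint : IntervalIntegrable (fun v : ℝ => 1 / (a + |v|)) volume (-1) 1 := hc.intervalIntegrable _ _
  have h0 : ∫ v in (0 : ℝ)..1, 1 / (a + |v|) = Real.log ((a + 1) / a) := by
    have : ∫ v in (0 : ℝ)..1, 1 / (a + |v|) = ∫ v in (0 : ℝ)..1, 1 / (a + v) := by
      refine intervalIntegral.integral_congr fun v hv => ?_
      rw [uIcc_of_le zero_le_one] at hv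
      simp only [abs_of_nonneg hv.1]
    rw [this, intervalIntegral.integral_comp_add_left (fun x => 1 / x), integral_one_div_of_pos
      (by linarith) (by linarith), add_zero]
  have h1 : ∫ v in (-1 : ℝ)..0, 1 / (a + |v|) = Real.log ((a + 1) / a) := by
    have := intervalIntegral.integral_comp_neg (fun v : ℝ => 1 / (a + |v|)) (a := 0) (b := 1)
    simp only [abs_neg, neg_zero] at this
    rw [← this, h0]
  calc _ = ENNReal.ofReal (∫ v in Ioo (-1 : ℝ) 1, 1 / (a + |v|)) := by
        refine (ofReal_integral_eq_lintegral_ofReal ?_ (ae_of_all _ fun v => by positivity)).symm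
        exact (intervalIntegrable_iff_integrableOn_Ioo_of_le (by norm_num)).1 hint
    _ = _ := by
        rw [← integral_Ioc_eq_integral_Ioo, ← intervalIntegral.integral_of_le (by norm_num),
          ← intervalIntegral.integral_add_adjacent_intervals (b := 0) (hc.intervalIntegrable _ _)
            (hc.intervalIntegrable _ _), h0, h1, two_mul]
    _ ≤ _ := le_rfl

/-- Near the saddle point of the energy, and below its critical value `m₀`, the measure of an
energy shell is controlled with a logarithmic loss. -/
theorem phase_shell_saddle_le {m₀ : ℝ} (hm : 0 < m₀) {τ : ℝ} (hτ : 0 ≤ τ) {c : ℝ} (hc : c < m₀)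
    (hc' : -m₀ ≤ c) :
    (phase.restrict {p | |p.2| < 1 ∧ Real.cos p.1 ≤ 0})
      {p | c - τ ≤ energy m₀ p ∧ energy m₀ p < c} ≤
      ENNReal.ofReal (4 * Real.pi / √m₀ * (Real.log (√(2 * m₀) + 1) + |Real.log (m₀ - c)|)) *
        ENNReal.ofReal τ := by
  have hR : MeasurableSet {p : ℝ × ℝ | |p.2| < 1 ∧ Real.cos p.1 ≤ 0} :=
    (measurableSet_lt (f := fun p : ℝ × ℝ => |p.2|) (by fun_prop) measurable_const).inter
      (measurableSet_le (f := fun p : ℝ × ℝ => Real.cos p.1) (by fun_prop) measurable_const)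
  have hS := measurableSet_shell m₀ (c - τ) c
  have hpi := Real.pi_pos
  set d := m₀ - c with hd
  have hd0 : 0 < d := by linarith
  have hsd : 0 < √d := Real.sqrt_pos.2 hd0
  have hsm : 0 < √m₀ := Real.sqrt_pos.2 hm
  rw [Measure.restrict_apply hS, phase, Measure.prod_apply_symm (hS.inter hR)]
  calc _ ≤ ∫⁻ v, (Ioo (-1 : ℝ) 1).indicator (fun v => ENNReal.ofReal (2 * Real.pi / √m₀ * τ) *
          ENNReal.ofReal (1 / (√d + |v|))) v := by
        refine lintegral_mono fun v => ?_
        by_cases hv : v ∈ Ioo (-1 : ℝ) 1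
        · rw [indicator_of_mem hv]
          -- A lower bound for `|sin θ|` that depends on `v`: energy below `c` gives `m₀ (1 + cos θ)
          -- > d + v² / 2`, and `sin² θ ≥ 1 + cos θ` when `cos θ ≤ 0`. Integrating its inverse over
          -- `v` produces the logarithm.
          have hκ : 0 < (√d + |v|) / (2 * √m₀) := by positivity
          refine ((volume_angle_slice_le hκ hm τ c (v ^ 2 / 2)).trans (le_of_eq ?_)).trans'
            (measure_mono fun θ hθ => ⟨?_, hθ.1⟩)
          · rw [← ENNReal.ofReal_add (by positivity) (by positivity),
              ← ENNReal.ofReal_mul (by positivity)]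
            congr 1
            field_simp
            rw [Real.sq_sqrt hm.le]
            ring
          · have hE : v ^ 2 / 2 + -m₀ * Real.cos θ < c := hθ.1.2
            have hcos : Real.cos θ ≤ 0 := hθ.2.2
            rw [← pow_le_pow_iff_left₀ hκ.le (abs_nonneg _) two_ne_zero, sq_abs, div_pow, mul_pow,
              Real.sq_sqrt hm.le, div_le_iff₀ (by positivity), Real.sin_sq]
            nlinarith [Real.sq_sqrt hd0.le, sq_abs v, sq_nonneg (√d - |v|),
              mul_nonneg hm.le (mul_nonneg (neg_nonneg.2 hcos)
                (by linarith [Real.neg_one_le_cos θ] : 0 ≤ 1 + Real.cos θ))]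
        · rw [indicator_of_notMem hv]
          refine le_of_eq ?_
          convert measure_empty (μ := volume.restrict (Ico (0 : ℝ) (2 * Real.pi)))
          ext θ
          simp only [mem_preimage, mem_inter_iff, mem_ofPred_eq, mem_empty_iff_false, iff_false]
          exact fun h => hv (abs_lt.1 h.2.1)
    _ = ENNReal.ofReal (2 * Real.pi / √m₀ * τ) *
          ∫⁻ v in Ioo (-1 : ℝ) 1, ENNReal.ofReal (1 / (√d + |v|)) := by
        rw [lintegral_indicator measurableSet_Ioo, lintegral_const_mul' _ _ ENNReal.ofReal_ne_top]
    _ ≤ ENNReal.ofReal (2 * Real.pi / √m₀ * τ) * ENNReal.ofReal (2 * Real.log ((√d + 1) / √d)) := by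
        gcongr
        exact lintegral_inv_add_abs_le hsd
    _ ≤ _ := by
        rw [← ENNReal.ofReal_mul (by positivity), ← ENNReal.ofReal_mul' hτ]
        refine ENNReal.ofReal_le_ofReal ?_
        have h1 : Real.log ((√d + 1) / √d) ≤ Real.log (√(2 * m₀) + 1) + |Real.log d| := by
          rw [Real.log_div (by positivity) hsd.ne', Real.log_sqrt hd0.le]
          have : Real.log (√d + 1) ≤ Real.log (√(2 * m₀) + 1) := by
            gcongr
            linarith
          linarith [neg_abs_le (Real.log d), abs_nonneg (Real.log d)]
        calc _ = 4 * Real.pi / √m₀ * Real.log ((√d + 1) / √d) * τ := by ring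
          _ ≤ _ := by gcongr

end HMF

/-! ### Monotonicity and regularity of the profile `F`. -/

namespace HMF

namespace IsSteadyState

variable {F : ℝ → ℝ} {eStar : WithTop ℝ} {m₀ : ℝ} {f₀ : ℝ × ℝ → ℝ}

theorem strict_decrease (h : IsSteadyState F eStar m₀ f₀) {a b : ℝ} (hab : a < b)
    (ha : (a : WithTop ℝ) < eStar) : F b < F a := by
  induction eStar using WithTop.recTopCoe with
  | top => exact strictAnti_of_deriv_neg (fun e => h.deriv_neg e (WithTop.coe_lt_top e)) hab
  | coe r =>
    have har : a < r := WithTop.coe_lt_coe.1 ha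
    have hs : StrictAntiOn F (Iic r) := strictAntiOn_of_deriv_neg (convex_Iic r)
      h.continuous.continuousOn fun x hx => by
        rw [interior_Iic] at hx
        exact h.deriv_neg x (WithTop.coe_lt_coe.2 hx)
    rcases le_total b r with hb | hb
    · exact hs har.le hb hab
    · rw [h.eq_zero b (WithTop.coe_le_coe.2 hb), ← h.eq_zero r le_rfl]
      exact hs har.le self_mem_Iic har

theorem nonneg (h : IsSteadyState F eStar m₀ f₀) (e : ℝ) : 0 ≤ F e := by
  rcases le_or_gt eStar e with he | he
  · exact (h.eq_zero e he).ge
  induction eStar using WithTop.recTopCoe with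
  | top =>
    refine le_of_tendsto (h.tendsto_zero rfl) ?_
    filter_upwards [eventually_gt_atTop e] with b hb
    exact (h.strict_decrease hb he).le
  | coe r =>
    rw [← h.eq_zero r le_rfl]
    exact (h.strict_decrease (WithTop.coe_lt_coe.1 he) he).le

theorem lt_of_pos (h : IsSteadyState F eStar m₀ f₀) {e : ℝ} (he : 0 < F e) :
    (e : WithTop ℝ) < eStar := by
  by_contra! hc
  exact he.ne' (h.eq_zero e hc)

theorem antitone (h : IsSteadyState F eStar m₀ f₀) : Antitone F := by
  intro a b hab
  rcases hab.eq_or_lt with rfl | hab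
  · exact le_rfl
  rcases (h.nonneg b).eq_or_lt with hb | hb
  · exact hb ▸ h.nonneg a
  · exact (h.strict_decrease hab ((WithTop.coe_lt_coe.2 hab).trans (h.lt_of_pos hb))).le

theorem pos_of_lt (h : IsSteadyState F eStar m₀ f₀) {e : ℝ} (he : (e : WithTop ℝ) < eStar) :
    0 < F e :=
  (h.nonneg (e + 1)).trans_lt (h.strict_decrease (lt_add_one e) he)

theorem exists_lt (h : IsSteadyState F eStar m₀ f₀) {s : ℝ} (hs : 0 < s) : ∃ b, F b < s := by
  induction eStar using WithTop.recTopCoe with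
  | top => exact ((h.tendsto_zero rfl).eventually (gt_mem_nhds hs)).exists
  | coe r => exact ⟨r, by rwa [h.eq_zero r le_rfl]⟩

/-- The super-level sets of `F` below its value at the bottom of the potential well are
half-lines. -/
theorem exists_level (h : IsSteadyState F eStar m₀ f₀) {s : ℝ} (hs : 0 < s) (hs' : s < F (-m₀)) :
    ∃ c, -m₀ ≤ c ∧ ∀ e, s < F e ↔ e < c := by
  obtain ⟨b, hb⟩ := h.exists_lt hs
  have hmb : -m₀ ≤ b := by
    by_contra! hc
    exact absurd (h.antitone hc.le) (by linarith)
  obtain ⟨c, hc, hFc⟩ := intermediate_value_Icc' hmb h.continuous.continuousOn ⟨hb.le, hs'.le⟩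
  refine ⟨c, hc.1, fun e => ⟨fun he => ?_, fun he => ?_⟩⟩
  · by_contra! hce
    exact absurd (h.antitone hce) (by linarith)
  · rw [← hFc]
    refine h.strict_decrease he ((WithTop.coe_lt_coe.2 he).trans (h.lt_of_pos ?_))
    rwa [hFc]

theorem profile_eq (h : IsSteadyState F eStar m₀ f₀) (p : ℝ × ℝ) : f₀ p = F (energy m₀ p) := by
  rw [h.eq_profile]; rfl

/-- Otherwise `f₀` would vanish identically, and so would its potential, contradicting `m₀ > 0`. -/
theorem bottom_lt (h : IsSteadyState F eStar m₀ f₀) : ((-m₀ : ℝ) : WithTop ℝ) < eStar := by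
  by_contra! hc
  have h0 : f₀ = fun _ => 0 := by
    funext p
    rw [h.profile_eq]
    exact h.eq_zero _ (hc.trans (WithTop.coe_le_coe.2 (neg_le_energy h.m₀_pos p)))
  have := h.self_consistent 0
  simp [potential, density, h0] at this
  exact h.m₀_pos.ne' this

theorem exists_lipschitz (h : IsSteadyState F eStar m₀ f₀) {c : ℝ} (hc : (c : WithTop ℝ) ≠ eStar) :
    ∃ K : NNReal, ∃ t ∈ 𝓝 c, LipschitzOnWith K F t := by
  rcases lt_or_gt_of_ne hc with hc | hc
  · refine ContDiffAt.exists_lipschitzOnWith (𝕂 := ℝ) (h.contDiffOn.contDiffAt ?_)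
    induction eStar using WithTop.recTopCoe with
    | top => simp
    | coe r =>
      have := Iio_mem_nhds (WithTop.coe_lt_coe.1 hc)
      filter_upwards [this] with x hx using WithTop.coe_lt_coe.2 hx
  · induction eStar using WithTop.recTopCoe with
    | top => simp at hc
    | coe r =>
      refine ⟨0, Ioi r, Ioi_mem_nhds (WithTop.coe_lt_coe.1 hc), ?_⟩
      intro x hx y hy
      rw [h.eq_zero x (WithTop.coe_le_coe.2 (le_of_lt hx)),
        h.eq_zero y (WithTop.coe_le_coe.2 (le_of_lt hy))]
      simp

/-- Small `τ` is handled by the local Lipschitz constant. For `τ ≥ δ / 3` the decrement is at most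
`F (c - δ)`, which is itself a multiple of `δ / 3`. -/
theorem exists_linear_decrement (h : IsSteadyState F eStar m₀ f₀) {c : ℝ}
    (hc : (c : WithTop ℝ) ≠ eStar) :
    ∃ ε > 0, ∃ K ≥ 0, ∀ e, |e - c| ≤ ε → ∀ τ ≥ 0, F e - F (e + τ) ≤ K * τ := by
  obtain ⟨K, t, ht, hK⟩ := h.exists_lipschitz hc
  obtain ⟨δ, hδ, hball⟩ := Metric.mem_nhds_iff.1 ht
  refine ⟨δ / 3, by positivity, max (K : ℝ) (F (c - δ) / (δ / 3)), le_max_of_le_left K.2, ?_⟩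
  intro e he τ hτ
  rcases le_total τ (δ / 3) with h1 | h1
  · have hx : e ∈ t := hball (by rw [Metric.mem_ball, Real.dist_eq]; linarith)
    have hy : e + τ ∈ t := hball (by
      rw [Metric.mem_ball, Real.dist_eq]
      calc |e + τ - c| = |(e - c) + τ| := by ring_nf
        _ ≤ |e - c| + |τ| := abs_add_le _ _
        _ < δ := by rw [abs_of_nonneg hτ]; linarith)
    have h2 := hK.dist_le_mul e hx (e + τ) hy
    rw [Real.dist_eq, Real.dist_eq, show e - (e + τ) = -τ by ring, abs_neg, abs_of_nonneg hτ] at h2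
    exact (le_abs_self _).trans (h2.trans (mul_le_mul_of_nonneg_right (le_max_left _ _) hτ))
  · have h2 : F e ≤ F (c - δ) := h.antitone (by linarith [(abs_le.1 he).1])
    calc F e - F (e + τ) ≤ F (c - δ) := by linarith [h.nonneg (e + τ)]
      _ = F (c - δ) / (δ / 3) * (δ / 3) := by field_simp
      _ ≤ max (K : ℝ) (F (c - δ) / (δ / 3)) * τ := by
        apply mul_le_mul (le_max_right _ _) h1 (by positivity)
        exact le_max_of_le_left K.2

end IsSteadyState

/-! ### The decrement bound, region by region. -/

/-- On the region `R`, raising the energy by `τ` lowers the integral of `F(energy)` by `O(τ)`. -/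
def DecrementBound (F : ℝ → ℝ) (m₀ : ℝ) (R : Set (ℝ × ℝ)) : Prop :=
  ∃ W : ℝ≥0∞, W ≠ ⊤ ∧ ∀ τ : ℝ, 0 ≤ τ →
    ∫⁻ p in R, (ENNReal.ofReal (F (energy m₀ p)) - ENNReal.ofReal (F (energy m₀ p + τ))) ∂phase ≤
      W * ENNReal.ofReal τ

variable {F : ℝ → ℝ} {eStar : WithTop ℝ} {m₀ : ℝ} {f₀ : ℝ × ℝ → ℝ}

theorem DecrementBound.mono {R S : Set (ℝ × ℝ)} (h : DecrementBound F m₀ S) (hRS : R ⊆ S) :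
    DecrementBound F m₀ R := by
  obtain ⟨W, hW, hb⟩ := h
  exact ⟨W, hW, fun τ hτ => (lintegral_mono_set hRS).trans (hb τ hτ)⟩

theorem DecrementBound.union {R S : Set (ℝ × ℝ)} (h : DecrementBound F m₀ R)
    (h' : DecrementBound F m₀ S) : DecrementBound F m₀ (R ∪ S) := by
  obtain ⟨W, hW, hb⟩ := h
  obtain ⟨W', hW', hb'⟩ := h'
  refine ⟨W + W', ENNReal.add_ne_top.2 ⟨hW, hW'⟩, fun τ hτ => ?_⟩
  rw [add_mul]
  exact (lintegral_union_le _ _ _).trans (add_le_add (hb τ hτ) (hb' τ hτ))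

theorem lintegral_decrement_eq (hF : Continuous F) (μ : Measure (ℝ × ℝ)) [SFinite μ] (τ : ℝ) :
    ∫⁻ p, (ENNReal.ofReal (F (energy m₀ p)) - ENNReal.ofReal (F (energy m₀ p + τ))) ∂μ =
      ∫⁻ s in Ioi (0 : ℝ), μ {p | F (energy m₀ p + τ) ≤ s ∧ s < F (energy m₀ p)} :=
  lintegral_ofReal_tsub_eq_lintegral_levels μ (hF.comp (continuous_energy m₀)).measurable
    (hF.comp ((continuous_energy m₀).add continuous_const)).measurable

namespace IsSteadyState

theorem decrement_set_eq_empty (h : IsSteadyState F eStar m₀ f₀) {s : ℝ} (hs : F (-m₀) ≤ s) (τ : ℝ) :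
    {p | F (energy m₀ p + τ) ≤ s ∧ s < F (energy m₀ p)} = ∅ := by
  ext p
  simp only [mem_ofPred_eq, mem_empty_iff_false, iff_false]
  intro hp
  linarith [h.antitone (neg_le_energy h.m₀_pos p)]

theorem lintegral_decrement_le (h : IsSteadyState F eStar m₀ f₀) (μ : Measure (ℝ × ℝ)) [SFinite μ]
    (τ : ℝ) :
    ∫⁻ p, (ENNReal.ofReal (F (energy m₀ p)) - ENNReal.ofReal (F (energy m₀ p + τ))) ∂μ ≤
      ∫⁻ s in Ioo 0 (F (-m₀)), μ {p | F (energy m₀ p + τ) ≤ s ∧ s < F (energy m₀ p)} := by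
  rw [lintegral_decrement_eq h.continuous μ τ, ← lintegral_indicator measurableSet_Ioi,
    ← lintegral_indicator measurableSet_Ioo]
  refine lintegral_mono fun s => ?_
  rcases lt_or_ge s (F (-m₀)) with hs | hs
  · by_cases h0 : 0 < s
    · rw [indicator_of_mem (show s ∈ Ioi 0 from h0), indicator_of_mem (show s ∈ Ioo _ _ from ⟨h0, hs⟩)]
    · rw [indicator_of_notMem (show s ∉ Ioi 0 from h0)]
      exact zero_le
  · refine le_trans (indicator_le_self _ _ _) ?_
    simp [h.decrement_set_eq_empty hs τ]

/-- A uniform bound on energy shells gives a decrement bound. -/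
theorem decrementBound_of_shell (h : IsSteadyState F eStar m₀ f₀) {R : Set (ℝ × ℝ)} {C : ℝ}
    (hC : ∀ τ : ℝ, 0 ≤ τ → ∀ c, (phase.restrict R) {p | c - τ ≤ energy m₀ p ∧ energy m₀ p < c} ≤
      ENNReal.ofReal C * ENNReal.ofReal τ) :
    DecrementBound F m₀ R := by
  refine ⟨ENNReal.ofReal C * ENNReal.ofReal (F (-m₀)),
    ENNReal.mul_ne_top ENNReal.ofReal_ne_top ENNReal.ofReal_ne_top, fun τ hτ => ?_⟩
  refine (h.lintegral_decrement_le (phase.restrict R) τ).trans ?_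
  calc _ ≤ ∫⁻ _ in Ioo 0 (F (-m₀)), ENNReal.ofReal C * ENNReal.ofReal τ := by
        refine setLIntegral_mono' measurableSet_Ioo fun s hs => ?_
        obtain ⟨c, -, hc⟩ := h.exists_level hs.1 hs.2
        refine le_trans (measure_mono fun p hp => ?_) (hC τ hτ c)
        refine ⟨?_, (hc _).1 hp.2⟩
        have := (not_congr (hc _)).1 (not_lt.2 hp.1)
        linarith
    _ = _ := by
        rw [lintegral_const, Measure.restrict_apply_univ, Real.volume_Ioo, sub_zero]
        ring

theorem decrementBound_of_linear (h : IsSteadyState F eStar m₀ f₀) {R : Set (ℝ × ℝ)} {K : ℝ}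
    (hR : R ⊆ {p | |p.2| < 1})
    (hK : ∀ p ∈ R, ∀ τ ≥ 0, F (energy m₀ p) - F (energy m₀ p + τ) ≤ K * τ) (hK0 : 0 ≤ K)
    (hRm : MeasurableSet R) :
    DecrementBound F m₀ R := by
  have hfin : phase R ≠ ⊤ := by
    refine ((measure_mono (t := univ ×ˢ Ioo (-1) 1) fun p hp => ?_).trans_lt ?_).ne
    · exact ⟨mem_univ _, abs_lt.1 (hR hp)⟩
    · rw [phase, Measure.prod_prod]
      simp [ENNReal.mul_lt_top_iff]
  refine ⟨ENNReal.ofReal K * phase R, ENNReal.mul_ne_top ENNReal.ofReal_ne_top hfin, fun τ hτ => ?_⟩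
  calc _ ≤ ∫⁻ _ in R, ENNReal.ofReal (K * τ) ∂phase := by
        refine setLIntegral_mono' hRm fun p hp => ?_
        rw [← ENNReal.ofReal_sub _ (h.nonneg _)]
        exact ENNReal.ofReal_le_ofReal (hK p hp τ hτ)
    _ = _ := by
        rw [lintegral_const, Measure.restrict_apply_univ, ENNReal.ofReal_mul hK0]
        ring

theorem measurableSet_corner (κ : ℝ) (S : Set ℝ) (hS : MeasurableSet S) :
    MeasurableSet {p : ℝ × ℝ | |p.2| < κ ∧ |Real.sin p.1| < κ ∧ Real.cos p.1 ∈ S} :=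
  (measurableSet_lt (f := fun p : ℝ × ℝ => |p.2|) (by fun_prop) measurable_const).inter
    ((measurableSet_lt (f := fun p : ℝ × ℝ => |Real.sin p.1|) (by fun_prop) measurable_const).inter
      ((Real.measurable_cos.comp measurable_fst) hS))

/-- Meant for the critical values `c = -m₀` (on `cos > 0`) and `c = m₀` (on `cos ≤ 0`), where `1 -
|cos θ| ≤ sin² θ` gives `hSc`. Small `v` and `sin θ` then confine the energy to a neighbourhood of
`c` where `F` has linear decrement. -/
theorem decrementBound_corner (h : IsSteadyState F eStar m₀ f₀) {S : Set ℝ} (hS : MeasurableSet S)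
    {c : ℝ} (hc : (c : WithTop ℝ) ≠ eStar)
    (hSc : ∀ θ, Real.cos θ ∈ S → |-m₀ * Real.cos θ - c| ≤ m₀ * Real.sin θ ^ 2) :
    ∃ κ > 0, DecrementBound F m₀
      {p : ℝ × ℝ | |p.2| < κ ∧ |Real.sin p.1| < κ ∧ Real.cos p.1 ∈ S} := by
  obtain ⟨ε, hε, K, hK0, hK⟩ := h.exists_linear_decrement hc
  have hm := h.m₀_pos
  -- With `κ ≤ 1`, both `v²` and `sin² θ` are at most `κ`, so the energy is within `κ (1 + m₀) ≤ ε`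
  -- of `c`.
  set κ := min 1 (ε / (1 + m₀)) with hκ
  have hκ0 : 0 < κ := by positivity
  have hκ1 : κ ≤ 1 := min_le_left _ _
  have hκε : κ * (1 + m₀) ≤ ε := by
    rw [← le_div_iff₀ (by positivity)]; exact min_le_right _ _
  refine ⟨κ, hκ0, h.decrementBound_of_linear (K := K) (fun p hp => lt_of_lt_of_le hp.1 hκ1) ?_ hK0
    (measurableSet_corner κ S hS)⟩
  rintro p ⟨hp1, hp2, hp3⟩ τ hτ
  refine hK _ ?_ τ hτ
  have h1 := hSc _ hp3
  have h2 : p.2 ^ 2 ≤ κ := by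
    rw [← sq_abs]; nlinarith [abs_nonneg p.2]
  have h3 : Real.sin p.1 ^ 2 ≤ κ := by
    rw [← sq_abs]; nlinarith [abs_nonneg (Real.sin p.1)]
  have h4 : energy m₀ p - c = p.2 ^ 2 / 2 + (-m₀ * Real.cos p.1 - c) := by unfold energy; ring
  rw [h4]
  calc _ ≤ |p.2 ^ 2 / 2| + |-m₀ * Real.cos p.1 - c| := abs_add_le _ _
    _ ≤ κ + m₀ * κ := by
        refine add_le_add ?_ (h1.trans (by gcongr))
        rw [abs_of_nonneg (by positivity)]; linarith
    _ ≤ ε := by linarith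

/-- The change of variables `s = F c` turns the integral over levels into one over energies `c ∈
(-m₀, m₀)` with weight `|F' c|`. The shell estimate contributes a constant plus `|log (m₀ - c)|`.
The constant part is finite because `∫ |F'|` is the length of the image of `F`, and the logarithmic
part by the hypothesis for `e_* = m₀`. -/
theorem decrementBound_saddle (h : IsSteadyState F eStar m₀ f₀) (he : eStar = (m₀ : WithTop ℝ)) :
    DecrementBound F m₀ {p : ℝ × ℝ | |p.2| < 1 ∧ Real.cos p.1 ≤ 0} := by
  have hlt : ∀ c ∈ Ioo (-m₀) m₀, (c : WithTop ℝ) < eStar := fun c hc =>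
    he ▸ WithTop.coe_lt_coe.2 hc.2
  have hderiv : ∀ c ∈ Ioo (-m₀) m₀, HasDerivWithinAt F (deriv F c) (Ioo (-m₀) m₀) c := fun c hc =>
    (differentiableAt_of_deriv_ne_zero (h.deriv_neg c (hlt c hc)).ne).hasDerivAt.hasDerivWithinAt
  have hinj : InjOn F (Ioo (-m₀) m₀) := by
    refine StrictAntiOn.injOn fun a ha b _ hab => h.strict_decrease hab (hlt a ha)
  have himg : Ioo 0 (F (-m₀)) ⊆ F '' Ioo (-m₀) m₀ := by
    intro s hs
    obtain ⟨c, hc, hFc⟩ := intermediate_value_Icc' (by linarith [h.m₀_pos] : -m₀ ≤ m₀)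
      h.continuous.continuousOn (⟨by rw [h.eq_zero m₀ he.le]; exact hs.1.le, hs.2.le⟩ :
        s ∈ Icc (F m₀) (F (-m₀)))
    refine ⟨c, ⟨lt_of_le_of_ne hc.1 ?_, lt_of_le_of_ne hc.2 ?_⟩, hFc⟩
    · rintro rfl; exact hs.2.ne' hFc
    · rintro rfl; exact hs.1.ne' (by rw [← hFc, h.eq_zero _ he.le])
  have himg' : F '' Ioo (-m₀) m₀ ⊆ Ioo 0 (F (-m₀)) := by
    rintro _ ⟨c, hc, rfl⟩
    exact ⟨h.pos_of_lt (hlt c hc), h.strict_decrease hc.1 h.bottom_lt⟩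
  set A : ℝ := 4 * Real.pi / √m₀ with hA
  set B : ℝ := Real.log (√(2 * m₀) + 1) with hB
  have hB0 : 0 ≤ B := Real.log_nonneg (by linarith [Real.sqrt_nonneg (2 * m₀)])
  have hA0 : 0 ≤ A := by have := Real.pi_pos; positivity
  refine ⟨∫⁻ c in Ioo (-m₀) m₀, ENNReal.ofReal |deriv F c| *
    ENNReal.ofReal (A * (B + |Real.log (m₀ - c)|)), ?_, fun τ hτ => ?_⟩
  · have hsplit : ∀ c, ENNReal.ofReal |deriv F c| * ENNReal.ofReal (A * (B + |Real.log (m₀ - c)|)) =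
        ENNReal.ofReal (A * B) * ENNReal.ofReal |deriv F c| +
          ENNReal.ofReal A * ENNReal.ofReal |Real.log (m₀ - c) * deriv F c| := by
      intro c
      rw [← ENNReal.ofReal_mul (by positivity), ← ENNReal.ofReal_mul (by positivity),
        ← ENNReal.ofReal_mul (by positivity), ← ENNReal.ofReal_add (by positivity) (by positivity),
        abs_mul]
      congr 1
      ring
    simp_rw [hsplit]
    rw [lintegral_add_left ((measurable_deriv F).abs.ennreal_ofReal.const_mul _),
      lintegral_const_mul' _ _ ENNReal.ofReal_ne_top, lintegral_const_mul' _ _ ENNReal.ofReal_ne_top]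
    refine ENNReal.add_ne_top.2 ⟨ENNReal.mul_ne_top ENNReal.ofReal_ne_top ?_,
      ENNReal.mul_ne_top ENNReal.ofReal_ne_top ?_⟩
    · have h1 := lintegral_image_eq_lintegral_abs_deriv_mul measurableSet_Ioo hderiv hinj fun _ => 1
      simp only [mul_one] at h1
      rw [← h1, setLIntegral_one]
      exact ((measure_mono himg').trans_lt (by simp)).ne
    · have h1 := (h.log_integrable he).hasFiniteIntegral
      rw [hasFiniteIntegral_iff_norm] at h1
      exact h1.ne
  · refine (h.lintegral_decrement_le _ τ).trans ?_
    refine (lintegral_mono_set himg).trans ?_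
    rw [lintegral_image_eq_lintegral_abs_deriv_mul measurableSet_Ioo hderiv hinj,
      ← lintegral_mul_const' _ _ ENNReal.ofReal_ne_top]
    refine setLIntegral_mono' measurableSet_Ioo fun c hc => ?_
    rw [mul_assoc]
    refine mul_le_mul_right (le_trans (measure_mono fun p hp => ?_)
      (phase_shell_saddle_le h.m₀_pos hτ hc.2 hc.1.le)) _
    refine ⟨?_, ?_⟩
    · by_contra! hcon
      have hcon' : energy m₀ p + τ < c := by linarith
      exact absurd (h.strict_decrease hcon' ((WithTop.coe_lt_coe.2 hcon').trans (hlt c hc)))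
        (not_lt.2 hp.1)
    · by_contra! hcon
      exact absurd (h.antitone hcon) (not_le.2 hp.2)

/-- The critical points of the energy have `v = 0` and `sin θ = 0`. Phase space is covered by the
regions where `|v|` or `|sin θ|` is at least `κ` and by corners around the minimum and the saddle.
-/
theorem decrementBound_univ (h : IsSteadyState F eStar m₀ f₀) : DecrementBound F m₀ univ := by
  have hm := h.m₀_pos
  obtain ⟨κ₁, hκ₁, h₁⟩ := h.decrementBound_corner (S := Ioi 0) measurableSet_Ioi h.bottom_lt.ne
    (fun θ hθ => by
      have hθ0 : 0 < Real.cos θ := hθ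
      have := Real.cos_le_one θ
      rw [Real.sin_sq, abs_of_nonneg (by nlinarith)]
      nlinarith [mul_nonneg hm.le (mul_nonneg hθ0.le (sub_nonneg.2 this))])
  obtain ⟨κ₂, hκ₂, h₂⟩ : ∃ κ > 0, DecrementBound F m₀
      {p : ℝ × ℝ | |p.2| < κ ∧ |Real.sin p.1| < κ ∧ Real.cos p.1 ∈ Iic 0} := by
    by_cases he : eStar = (m₀ : WithTop ℝ)
    · exact ⟨1, one_pos, (h.decrementBound_saddle he).mono fun p hp => ⟨hp.1, hp.2.2⟩⟩
    · refine h.decrementBound_corner measurableSet_Iic (Ne.symm he) fun θ hθ => ?_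
      have hθ0 : Real.cos θ ≤ 0 := hθ
      have := Real.neg_one_le_cos θ
      rw [Real.sin_sq, abs_of_nonpos (by nlinarith)]
      nlinarith [mul_nonneg hm.le (mul_nonneg (neg_nonneg.2 hθ0) (by linarith : 0 ≤ 1 + Real.cos θ))]
  set κ := min κ₁ κ₂
  have hκ : 0 < κ := lt_min hκ₁ hκ₂
  have h₃ : DecrementBound F m₀ {p | κ ≤ |p.2|} :=
    h.decrementBound_of_shell fun τ hτ c => phase_shell_large_velocity_le m₀ hκ hτ c
  have h₄ : DecrementBound F m₀ {p | |p.2| < κ ∧ κ ≤ |Real.sin p.1|} :=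
    h.decrementBound_of_shell fun τ hτ c => phase_shell_large_sin_le hm hκ hτ c
  refine (((h₃.union h₄).union h₁).union h₂).mono fun p _ => ?_
  rcases le_or_gt κ |p.2| with hv | hv
  · exact Or.inl (Or.inl (Or.inl hv))
  rcases le_or_gt κ |Real.sin p.1| with hs | hs
  · exact Or.inl (Or.inl (Or.inr ⟨hv, hs⟩))
  rcases le_or_gt (Real.cos p.1) 0 with hc | hc
  · exact Or.inr ⟨hv.trans_le (min_le_right _ _), hs.trans_le (min_le_right _ _), hc⟩
  · exact Or.inl (Or.inr ⟨hv.trans_le (min_le_left _ _), hs.trans_le (min_le_left _ _), hc⟩)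

end IsSteadyState

end HMF

/-! ### Comparison at a fixed level, and integration over levels. -/

namespace HMF

/-- Comparison of a set `E` with a sub-level set `A` of `h` (at level `η`), with a penalization of
the difference of their measures. -/
theorem sublevel_comparison {α : Type*} [MeasurableSpace α] {μ : Measure α} {h : α → ℝ≥0∞}
    {A E D : Set α} {η τ m k : ℝ≥0∞} (hA : MeasurableSet A) (hE : MeasurableSet E)
    (hD : MeasurableSet D) (hAfin : μ A ≠ ⊤) (h_out : ∀ p ∉ A, η ≤ h p) (h_in : ∀ p ∈ A, h p ≤ η)
    (h_deep : ∀ p ∈ A, p ∉ D → τ + h p ≤ η) (hη : η ≤ m + m + k * μ A ^ 2) :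
    τ * μ (A \ E) + ∫⁻ p in A, h p ∂μ + m * μ E ≤
      ∫⁻ p in E, h p ∂μ + m * μ A + m * ((μ E - μ A) + (μ A - μ E)) +
        k * (μ A ^ 2 * (μ A - μ E)) + τ * μ D := by
  have hAE := measure_inter_add_sdiff (μ := μ) A hE
  have hEA := measure_inter_add_sdiff (μ := μ) E hA
  have iAE := lintegral_inter_add_sdiff (μ := μ) h A hE
  have iEA := lintegral_inter_add_sdiff (μ := μ) h E hA
  rw [inter_comm] at hEA iEA
  have hx : μ (A ∩ E) ≠ ⊤ := measure_ne_top_of_subset inter_subset_left hAfin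
  -- Points of `A \ E` outside `D` lie at depth at least `τ` below the level `η`; the others are
  -- charged to `τ * μ D`.
  have h1 : τ * μ (A \ E) + ∫⁻ p in A \ E, h p ∂μ ≤ η * μ (A \ E) + τ * μ D := by
    calc _ = ∫⁻ p in A \ E, (τ + h p) ∂μ := by
          rw [lintegral_add_left measurable_const, setLIntegral_const]
      _ ≤ ∫⁻ p in A \ E, (η + D.indicator (fun _ => τ) p) ∂μ := by
          refine setLIntegral_mono' (hA.diff hE) fun p hp => ?_
          by_cases hpD : p ∈ D
          · rw [indicator_of_mem hpD, add_comm]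
            exact add_le_add (h_in p hp.1) le_rfl
          · rw [indicator_of_notMem hpD, add_zero]
            exact h_deep p hp.1 hpD
      _ = η * μ (A \ E) + ∫⁻ p in A \ E, D.indicator (fun _ => τ) p ∂μ := by
          rw [lintegral_add_left measurable_const, setLIntegral_const]
      _ ≤ η * μ (A \ E) + ∫⁻ p, D.indicator (fun _ => τ) p ∂μ := by
          gcongr
          exact Measure.restrict_le_self
      _ = _ := by rw [lintegral_indicator hD, setLIntegral_const]
  have h2 : η * μ (E \ A) ≤ ∫⁻ p in E \ A, h p ∂μ := by
    rw [← setLIntegral_const]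
    exact setLIntegral_mono' (hE.diff hA) fun p hp => h_out p hp.2
  -- If `E` is the larger set, only `m * μ E` needs compensation. If `A` is larger by `δ`, then `η δ
  -- ≤ (2m + k μ(A)²) δ`: one `m δ` completes `m * μ E` to `m * μ A`, the other is the penalty.
  have h3 : η * μ (A \ E) + m * μ E ≤ η * μ (E \ A) + m * μ A + m * ((μ E - μ A) + (μ A - μ E)) +
      k * (μ A ^ 2 * (μ A - μ E)) := by
    rcases le_total (μ (A \ E)) (μ (E \ A)) with hle | hle
    · have hAleE : μ A ≤ μ E := by rw [← hAE, ← hEA]; gcongr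
      calc η * μ (A \ E) + m * μ E ≤ η * μ (E \ A) + m * (μ A + (μ E - μ A)) := by
            rw [add_tsub_cancel_of_le hAleE]; gcongr
        _ ≤ η * μ (E \ A) + m * μ A + m * ((μ E - μ A) + (μ A - μ E)) := by
            rw [mul_add, ← add_assoc]
            gcongr
            exact le_self_add
        _ ≤ _ := le_self_add
    · have hEleA : μ E ≤ μ A := by rw [← hAE, ← hEA]; gcongr
      have hδ : μ A - μ E = μ (A \ E) - μ (E \ A) := by
        rw [← hAE, ← hEA, ENNReal.add_sub_add_eq_sub_left hx]
      set δ := μ A - μ E with hδdef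
      have hb : μ (A \ E) = μ (E \ A) + δ := by rw [hδ, add_tsub_cancel_of_le hle]
      have ha : μ A = μ E + δ := (add_tsub_cancel_of_le hEleA).symm
      calc η * μ (A \ E) + m * μ E = η * μ (E \ A) + η * δ + m * μ E := by rw [hb, mul_add]
        _ ≤ η * μ (E \ A) + (m + m + k * μ A ^ 2) * δ + m * μ E := by gcongr
        _ = η * μ (E \ A) + m * (μ E + δ) + m * (0 + δ) + k * (μ A ^ 2 * δ) := by ring
        _ ≤ _ := by
          rw [← ha]
          gcongr
          exact zero_le
  calc τ * μ (A \ E) + ∫⁻ p in A, h p ∂μ + m * μ E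
      = (∫⁻ p in A ∩ E, h p ∂μ) + (τ * μ (A \ E) + ∫⁻ p in A \ E, h p ∂μ) + m * μ E := by
        rw [← iAE]; ring
    _ ≤ (∫⁻ p in A ∩ E, h p ∂μ) + (η * μ (A \ E) + τ * μ D) + m * μ E := by gcongr
    _ = (∫⁻ p in A ∩ E, h p ∂μ) + (η * μ (A \ E) + m * μ E) + τ * μ D := by ring
    _ ≤ (∫⁻ p in A ∩ E, h p ∂μ) + (η * μ (E \ A) + m * μ A + m * ((μ E - μ A) + (μ A - μ E)) +
          k * (μ A ^ 2 * (μ A - μ E))) + τ * μ D := by gcongr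
    _ = ((∫⁻ p in A ∩ E, h p ∂μ) + η * μ (E \ A)) + m * μ A + m * ((μ E - μ A) + (μ A - μ E)) +
          k * (μ A ^ 2 * (μ A - μ E)) + τ * μ D := by ring
    _ ≤ _ := by
        rw [← iEA]
        gcongr

theorem phase_velocity_strip (R : ℝ) :
    phase {p : ℝ × ℝ | |p.2| < R} = ENNReal.ofReal (4 * Real.pi * R) := by
  have hpi := Real.pi_pos
  have : {p : ℝ × ℝ | |p.2| < R} = univ ×ˢ Ioo (-R) R := by
    ext p; simp [abs_lt]
  rw [this, phase, Measure.prod_prod, Measure.restrict_apply_univ, Real.volume_Ico,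
    Real.volume_Ioo, ← ENNReal.ofReal_mul (by linarith)]
  congr 1
  ring

/-- Upper bound of an energy level in terms of the measure of the sub-level set. -/
theorem level_le_of_phase_sublevel {m₀ : ℝ} (hm : 0 < m₀) (c : ℝ) :
    ENNReal.ofReal (c + m₀) ≤ ENNReal.ofReal m₀ + ENNReal.ofReal m₀ +
      ENNReal.ofReal (1 / (8 * Real.pi ^ 2)) * phase {p | energy m₀ p < c} ^ 2 := by
  have hpi := Real.pi_pos
  rw [← ENNReal.ofReal_add hm.le hm.le]
  rcases le_total c m₀ with hc | hc
  · exact (ENNReal.ofReal_le_ofReal (by linarith)).trans le_self_add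
  have h0 : 0 ≤ 2 * (c - m₀) := by linarith
  -- For `c ≥ m₀` the sub-level set contains the strip `v² < 2 (c - m₀)`. Its squared area divided
  -- by `8π²` is `4 (c - m₀)`, more than the `c - m₀` required.
  have h1 : ENNReal.ofReal (4 * Real.pi * √(2 * (c - m₀))) ≤ phase {p | energy m₀ p < c} := by
    rw [← phase_velocity_strip]
    refine measure_mono fun p hp => ?_
    have hp' : |p.2| < √(2 * (c - m₀)) := hp
    rw [Real.lt_sqrt (abs_nonneg _), sq_abs] at hp'
    have := Real.neg_one_le_cos p.1
    simp only [mem_ofPred_eq, energy]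
    nlinarith
  calc ENNReal.ofReal (c + m₀)
      ≤ ENNReal.ofReal ((m₀ + m₀) + 1 / (8 * Real.pi ^ 2) * (4 * Real.pi * √(2 * (c - m₀))) ^ 2) := by
        refine ENNReal.ofReal_le_ofReal ?_
        rw [mul_pow, Real.sq_sqrt h0]
        field_simp
        nlinarith
    _ = ENNReal.ofReal (m₀ + m₀) + ENNReal.ofReal (1 / (8 * Real.pi ^ 2)) *
          ENNReal.ofReal (4 * Real.pi * √(2 * (c - m₀))) ^ 2 := by
        rw [ENNReal.ofReal_add (by positivity) (by positivity), ENNReal.ofReal_mul (by positivity),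
          ENNReal.ofReal_pow (by positivity)]
    _ ≤ _ := by gcongr

/-- A set of given measure has at least the kinetic energy of a comparable velocity strip. -/
theorem phase_cube_le_kinetic {A : Set (ℝ × ℝ)} (hA : MeasurableSet A) (hfin : phase A ≠ ⊤) :
    phase A ^ 3 ≤ ENNReal.ofReal (128 * Real.pi ^ 2) *
      ∫⁻ p in A, ENNReal.ofReal (p.2 ^ 2) ∂phase := by
  have hpi := Real.pi_pos
  set m := (phase A).toReal with hm
  have hm0 : 0 ≤ m := ENNReal.toReal_nonneg
  have hAm : phase A = ENNReal.ofReal m := (ENNReal.ofReal_toReal hfin).symm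
  -- The strip `|v| < R` has area `m / 2`, so at least half of `A` lies where `v² ≥ R²`; and `R² m /
  -- 2 = m³ / (128 π²)`.
  set R := m / (8 * Real.pi) with hR
  have hR0 : 0 ≤ R := by positivity
  set S : Set (ℝ × ℝ) := {p | |p.2| < R}
  have hS : MeasurableSet S := measurableSet_lt (by fun_prop) (by fun_prop)
  have h1 : ENNReal.ofReal m ≤ ENNReal.ofReal (m / 2) + phase (A \ S) := by
    rw [← hAm, ← measure_inter_add_sdiff A hS]
    gcongr
    refine (measure_mono inter_subset_right).trans (le_of_eq ?_)
    rw [phase_velocity_strip, hR]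
    congr 1
    field_simp
    ring
  have h2 : ENNReal.ofReal (m / 2) ≤ phase (A \ S) := by
    rw [← tsub_le_iff_left, ← ENNReal.ofReal_sub _ (by positivity)] at h1
    rwa [show m - m / 2 = m / 2 by ring] at h1
  have h3 : ENNReal.ofReal (R ^ 2) * phase (A \ S) ≤ ∫⁻ p in A, ENNReal.ofReal (p.2 ^ 2) ∂phase := by
    rw [← setLIntegral_const]
    refine (setLIntegral_mono' (hA.diff hS) fun p hp => ENNReal.ofReal_le_ofReal ?_).trans
      (lintegral_mono_set sdiff_subset)
    rw [← sq_abs p.2]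
    exact pow_le_pow_left₀ hR0 (not_lt.1 hp.2) 2
  calc phase A ^ 3 = ENNReal.ofReal (128 * Real.pi ^ 2) *
        (ENNReal.ofReal (R ^ 2) * ENNReal.ofReal (m / 2)) := by
        rw [hAm, ← ENNReal.ofReal_pow hm0, ← ENNReal.ofReal_mul (by positivity),
          ← ENNReal.ofReal_mul (by positivity), hR]
        congr 1
        field_simp
        ring
    _ ≤ _ := by
        gcongr
        exact (mul_le_mul_right h2 _).trans h3

/-- Since `beta` is at most `distrib f₀`, the integrand is at most `distrib f₀ ^ 3`, hence at most a
multiple of the kinetic energy of `{f₀ > s}`. Integrating over `s` gives the kinetic energy of `f₀`.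
-/
theorem betaTerm_lt_top {f f₀ : ℝ × ℝ → ℝ} (hf₀ : Measurable f₀)
    (hfin : ∫⁻ p, ENNReal.ofReal (f₀ p) ∂phase ≠ ⊤)
    (hkin : ∫⁻ p, ENNReal.ofReal (p.2 ^ 2) * ENNReal.ofReal (f₀ p) ∂phase ≠ ⊤) :
    betaTerm f f₀ < ⊤ := by
  have hw : Measurable fun p : ℝ × ℝ => ENNReal.ofReal (p.2 ^ 2) := by fun_prop
  have h1 : ∫⁻ s in Ioi (0 : ℝ), (phase.withDensity fun p => ENNReal.ofReal (p.2 ^ 2)) {p | s < f₀ p} =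
      ∫⁻ p, ENNReal.ofReal (p.2 ^ 2) * ENNReal.ofReal (f₀ p) ∂phase := by
    rw [← lintegral_ofReal_eq_lintegral_levels _ hf₀,
      lintegral_withDensity_eq_lintegral_mul _ hw hf₀.ennreal_ofReal]
    rfl
  calc betaTerm f f₀ ≤ ∫⁻ s in Ioi (0 : ℝ), ENNReal.ofReal (128 * Real.pi ^ 2) *
        (phase.withDensity fun p => ENNReal.ofReal (p.2 ^ 2)) {p | s < f₀ p} := by
        refine setLIntegral_mono' measurableSet_Ioi fun s hs => ?_
        have hs0 : 0 < s := hs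
        have hne := distrib_ne_top hf₀ hfin hs0
        have hA : MeasurableSet {p | s < f₀ p} := measurableSet_lt measurable_const hf₀
        have hbeta : beta (rearr f) (rearr f₀) s ≤ distrib f₀ s := by
          rw [← phase_ofReal_lt_rearr hs0.le hne]
          exact measure_mono fun p hp => hp.2
        rw [withDensity_apply _ hA]
        calc _ ≤ distrib f₀ s ^ 2 * distrib f₀ s := by gcongr
          _ = distrib f₀ s ^ 3 := by ring
          _ ≤ _ := phase_cube_le_kinetic hA hne
    _ < ⊤ := by
        rw [lintegral_const_mul' _ _ ENNReal.ofReal_ne_top, h1]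
        exact ENNReal.mul_lt_top ENNReal.ofReal_lt_top hkin.lt_top

namespace IsSteadyState

variable {F : ℝ → ℝ} {eStar : WithTop ℝ} {m₀ : ℝ} {f₀ : ℝ × ℝ → ℝ}

theorem measurable (h : IsSteadyState F eStar m₀ f₀) : Measurable f₀ := by
  have : f₀ = fun p => F (energy m₀ p) := funext h.profile_eq
  rw [this]
  exact (h.continuous.comp (continuous_energy m₀)).measurable

/-- The energy is shifted by `m₀` to be nonnegative. The terms `m₀ * distrib` undo the shift; each
stands on the side that avoids a subtraction in `[0, ∞]`. -/
theorem level_comparison (h : IsSteadyState F eStar m₀ f₀) {f : ℝ × ℝ → ℝ} (hf : Measurable f)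
    (hfin₀ : ∫⁻ p, ENNReal.ofReal (f₀ p) ∂phase ≠ ⊤) {τ : ℝ} (hτ : 0 ≤ τ) {s : ℝ} (hs : 0 < s) :
    ENNReal.ofReal τ * phase {p | f p ≤ s ∧ s < f₀ p} +
        (phase.withDensity fun p => ENNReal.ofReal (energy m₀ p + m₀)) {p | s < f₀ p} +
        ENNReal.ofReal m₀ * distrib f s ≤
      (phase.withDensity fun p => ENNReal.ofReal (energy m₀ p + m₀)) {p | s < f p} +
        ENNReal.ofReal m₀ * distrib f₀ s +
        ENNReal.ofReal m₀ * ((distrib f s - distrib f₀ s) + (distrib f₀ s - distrib f s)) +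
        ENNReal.ofReal (1 / (8 * Real.pi ^ 2)) * (distrib f₀ s ^ 2 * (distrib f₀ s - distrib f s)) +
        ENNReal.ofReal τ * phase {p | F (energy m₀ p + τ) ≤ s ∧ s < F (energy m₀ p)} := by
  have hA : MeasurableSet {p | s < f₀ p} := measurableSet_lt measurable_const h.measurable
  have hE : MeasurableSet {p | s < f p} := measurableSet_lt measurable_const hf
  have hD : MeasurableSet {p | F (energy m₀ p + τ) ≤ s ∧ s < F (energy m₀ p)} :=
    (measurableSet_le (h.continuous.comp ((continuous_energy m₀).add continuous_const)).measurable
      measurable_const).inter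
    (measurableSet_lt measurable_const (h.continuous.comp (continuous_energy m₀)).measurable)
  have hAfin : phase {p | s < f₀ p} ≠ ⊤ := distrib_ne_top h.measurable hfin₀ hs
  have hdiff : {p | f p ≤ s ∧ s < f₀ p} = {p | s < f₀ p} \ {p | s < f p} := by
    ext p
    simp only [Set.mem_sdiff, mem_ofPred_eq, not_lt]
    exact and_comm
  rw [withDensity_apply _ hA, withDensity_apply _ hE, hdiff]
  rcases lt_or_ge s (F (-m₀)) with hs' | hs'
  · obtain ⟨c, hc, hlev⟩ := h.exists_level hs hs'
    have hAc : ∀ p, s < f₀ p ↔ energy m₀ p < c := fun p => by rw [h.profile_eq, hlev]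
    refine sublevel_comparison (η := ENNReal.ofReal (c + m₀)) hA hE hD hAfin
      (fun p hp => ?_) (fun p hp => ?_) (fun p hp hpD => ?_) ?_
    · have : c ≤ energy m₀ p := not_lt.1 fun hlt => hp ((hAc p).2 hlt)
      exact ENNReal.ofReal_le_ofReal (by linarith)
    · have : energy m₀ p < c := (hAc p).1 hp
      exact ENNReal.ofReal_le_ofReal (by linarith)
    · have h1 : s < F (energy m₀ p) := by rw [← h.profile_eq]; exact hp
      have h2 : s < F (energy m₀ p + τ) := not_le.1 fun hle => hpD ⟨hle, h1⟩
      have h3 := (hlev _).1 h2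
      rw [← ENNReal.ofReal_add hτ (by linarith [neg_le_energy h.m₀_pos p])]
      exact ENNReal.ofReal_le_ofReal (by linarith)
    · simp only [hAc]
      exact level_le_of_phase_sublevel h.m₀_pos c
  -- Above the maximum `F (-m₀)` of the profile the set `A` is empty, and the comparison holds with
  -- level `η = 0`.
  · have hempty : ∀ p, ¬ s < f₀ p := fun p => by
      rw [h.profile_eq]
      exact not_lt.2 ((h.antitone (neg_le_energy h.m₀_pos p)).trans hs')
    exact sublevel_comparison (η := 0) hA hE hD hAfin (fun p _ => zero_le)
      (fun p hp => absurd hp (hempty p)) (fun p hp => absurd hp (hempty p)) zero_le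

theorem lintegral_comparison (h : IsSteadyState F eStar m₀ f₀) {f : ℝ × ℝ → ℝ} (hf : Measurable f)
    (hfin : ∫⁻ p, ENNReal.ofReal (f p) ∂phase ≠ ⊤)
    (hfin₀ : ∫⁻ p, ENNReal.ofReal (f₀ p) ∂phase ≠ ⊤) {τ : ℝ} (hτ : 0 ≤ τ) :
    ENNReal.ofReal τ * ∫⁻ p, (ENNReal.ofReal (f₀ p) - ENNReal.ofReal (f p)) ∂phase +
        ∫⁻ p, ENNReal.ofReal (energy m₀ p + m₀) * ENNReal.ofReal (f₀ p) ∂phase +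
        ENNReal.ofReal m₀ * ∫⁻ p, ENNReal.ofReal (f p) ∂phase ≤
      ∫⁻ p, ENNReal.ofReal (energy m₀ p + m₀) * ENNReal.ofReal (f p) ∂phase +
        ENNReal.ofReal m₀ * ∫⁻ p, ENNReal.ofReal (f₀ p) ∂phase +
        ENNReal.ofReal m₀ * distL1 (rearr f) (rearr f₀) +
        ENNReal.ofReal (1 / (8 * Real.pi ^ 2)) * betaTerm f f₀ +
        ENNReal.ofReal τ * ∫⁻ p, (ENNReal.ofReal (F (energy m₀ p)) -
          ENNReal.ofReal (F (energy m₀ p + τ))) ∂phase := by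
  have hm := h.measurable
  have hw : Measurable fun p : ℝ × ℝ => ENNReal.ofReal (energy m₀ p + m₀) :=
    ((continuous_energy m₀).measurable.add_const m₀).ennreal_ofReal
  have hweight : ∀ {g : ℝ × ℝ → ℝ}, Measurable g →
      ∫⁻ p, ENNReal.ofReal (energy m₀ p + m₀) * ENNReal.ofReal (g p) ∂phase =
        ∫⁻ s in Ioi (0 : ℝ),
          (phase.withDensity fun p => ENNReal.ofReal (energy m₀ p + m₀)) {p | s < g p} := by
    intro g hg
    rw [← lintegral_ofReal_eq_lintegral_levels _ hg,
      lintegral_withDensity_eq_lintegral_mul _ hw hg.ennreal_ofReal]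
    rfl
  have hd : ∀ g, Measurable (distrib g) := fun g => (distrib_antitone g).measurable
  have hmass : ∀ {g : ℝ × ℝ → ℝ}, Measurable g →
      ∫⁻ p, ENNReal.ofReal (g p) ∂phase = ∫⁻ s in Ioi (0 : ℝ), distrib g s :=
    fun hg => lintegral_ofReal_eq_lintegral_levels phase hg
  have hbeta : ∫⁻ s in Ioi (0 : ℝ), distrib f₀ s ^ 2 * (distrib f₀ s - distrib f s) ≤
      betaTerm f f₀ :=
    setLIntegral_mono' measurableSet_Ioi fun s hs => mul_le_mul_right
      (tsub_distrib_le_beta_rearr (le_of_lt hs) (distrib_ne_top hf hfin hs)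
        (distrib_ne_top hm hfin₀ hs)) _
  have hdist := lintegral_tsub_distrib_le_distL1 hf hm hfin hfin₀
  have hmono := setLIntegral_mono' (μ := volume) measurableSet_Ioi fun s (hs : s ∈ Ioi (0 : ℝ)) =>
    h.level_comparison hf hfin₀ hτ hs
  have hm1 := measurable_measure_lt (phase.withDensity fun p => ENNReal.ofReal (energy m₀ p + m₀)) f
  have hm0 := measurable_measure_lt (phase.withDensity fun p => ENNReal.ofReal (energy m₀ p + m₀)) f₀
  have hm2 := measurable_measure_le_and_lt phase hm hf
  have hm3 : Measurable fun s => ENNReal.ofReal m₀ *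
      ((distrib f s - distrib f₀ s) + (distrib f₀ s - distrib f s)) :=
    (((hd f).sub (hd f₀)).add ((hd f₀).sub (hd f))).const_mul _
  have hm4 : Measurable fun s => ENNReal.ofReal (1 / (8 * Real.pi ^ 2)) *
      (distrib f₀ s ^ 2 * (distrib f₀ s - distrib f s)) :=
    (((hd f₀).pow_const 2).mul ((hd f₀).sub (hd f))).const_mul _
  have hm5 := (hd f₀).const_mul (ENNReal.ofReal m₀)
  rw [lintegral_add_left, lintegral_add_left, lintegral_add_left, lintegral_add_left,
    lintegral_add_left, lintegral_add_left] at hmono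
  rotate_left
  iterate 6 fun_prop
  simp only [lintegral_const_mul' _ _ ENNReal.ofReal_ne_top] at hmono
  rw [hweight hf, hweight hm, hmass hf, hmass hm, lintegral_ofReal_tsub_eq_lintegral_levels _ hm hf,
    lintegral_decrement_eq h.continuous]
  refine hmono.trans ?_
  gcongr

end IsSteadyState

end HMF

/-! ### Passage to real integrals, optimization in `τ`, and conclusion. -/

namespace HMF

theorem InEnergySpace.integrable_mul {f w : ℝ × ℝ → ℝ} (hf : InEnergySpace f) (hw : Continuous w)
    {C : ℝ} (hC : ∀ p, |w p| ≤ C * (1 + p.2 ^ 2)) : Integrable (fun p => w p * f p) phase := by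
  have hpos : ∀ p : ℝ × ℝ, 0 < 1 + p.2 ^ 2 := fun p => by positivity
  have hc : Continuous fun p : ℝ × ℝ => w p / (1 + p.2 ^ 2) :=
    hw.div (by fun_prop) fun p => (hpos p).ne'
  have := Integrable.bdd_mul (c := C) hf hc.aestronglyMeasurable (ae_of_all _ fun p => by
    rw [Real.norm_eq_abs, abs_div, abs_of_pos (hpos p), div_le_iff₀ (hpos p)]
    exact hC p)
  refine this.congr (ae_of_all _ fun p => ?_)
  have := (hpos p).ne'
  field_simp

theorem InEnergySpace.integrable {f : ℝ × ℝ → ℝ} (hf : InEnergySpace f) : Integrable f phase := by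
  simpa using hf.integrable_mul (w := fun _ => 1) continuous_const (C := 1)
    fun p => by rw [abs_one]; nlinarith [sq_nonneg p.2]

theorem InEnergySpace.integrable_kinetic {f : ℝ × ℝ → ℝ} (hf : InEnergySpace f) :
    Integrable (fun p => p.2 ^ 2 * f p) phase :=
  hf.integrable_mul (w := fun p => p.2 ^ 2) (by fun_prop) (C := 1)
    fun p => by rw [abs_of_nonneg (by positivity)]; linarith

theorem InEnergySpace.integrable_energy {f : ℝ × ℝ → ℝ} (hf : InEnergySpace f) (m₀ : ℝ) :
    Integrable (fun p => energy m₀ p * f p) phase := by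
  refine hf.integrable_mul (continuous_energy m₀) (C := 1 + |m₀|) fun p => ?_
  have h1 : |energy m₀ p| ≤ p.2 ^ 2 / 2 + |m₀| := by
    refine (abs_add_le _ _).trans (add_le_add (abs_of_nonneg (by positivity)).le ?_)
    rw [abs_mul, abs_neg]
    exact mul_le_of_le_one_right (abs_nonneg _) (Real.abs_cos_le_one _)
  nlinarith [abs_nonneg m₀, sq_nonneg p.2, mul_nonneg (abs_nonneg m₀) (sq_nonneg p.2)]

theorem InEnergySpace.congr {f g : ℝ × ℝ → ℝ} (hf : InEnergySpace f) (hfg : f =ᵐ[phase] g) :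
    InEnergySpace g :=
  Integrable.congr hf (hfg.mono fun p hp => by simp only [hp])

theorem rearr_congr {f g : ℝ × ℝ → ℝ} (hfg : f =ᵐ[phase] g) : rearr f = rearr g := by
  have : distrib f = distrib g := funext fun s => measure_congr (hfg.mono fun p hp => by
    simp only [eq_iff_iff]
    change s < f p ↔ s < g p
    rw [hp])
  unfold rearr sharp
  rw [this]

/-- The optimal choice is `τ = I / (2W)`. -/
theorem sq_le_of_forall_mul_le {I B W : ℝ} (hW : 0 < W)
    (h : ∀ τ, 0 ≤ τ → τ * I ≤ B + τ * (W * τ)) (hI : 0 ≤ I) : I ^ 2 ≤ 4 * W * B := by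
  have h1 := h (I / (2 * W)) (by positivity)
  have h2 : I / (2 * W) * (W * (I / (2 * W))) = I ^ 2 / (4 * W) := by field_simp; ring
  have h3 : I / (2 * W) * I = 2 * (I ^ 2 / (4 * W)) := by field_simp; ring
  rw [h2, h3] at h1
  have h4 : I ^ 2 / (4 * W) ≤ B := by linarith
  rw [div_le_iff₀ (by positivity)] at h4
  linarith

theorem normL1_sub_add_sub {f g : ℝ × ℝ → ℝ} (hf : Integrable f phase) (hg : Integrable g phase)
    (hf0 : ∀ p, 0 ≤ f p) (hg0 : ∀ p, 0 ≤ g p) :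
    normL1 (fun p => f p - g p) + normL1 g - normL1 f = 2 * ∫ p, max (g p - f p) 0 ∂phase := by
  have hd : Integrable (fun p => |f p - g p|) phase := (hf.sub hg).abs
  have hs : Integrable (fun p => |f p - g p| + |g p|) phase := hd.add hg.abs
  unfold normL1
  rw [← integral_add hd hg.abs, ← integral_sub hs hf.abs, ← integral_const_mul]
  refine integral_congr_ae (ae_of_all _ fun p => ?_)
  simp only [abs_of_nonneg (hf0 p), abs_of_nonneg (hg0 p)]
  rcases le_total (g p) (f p) with h | h
  · rw [abs_of_nonneg (by linarith), max_eq_right (by linarith)]; ring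
  · rw [abs_of_nonpos (by linarith), max_eq_left (by linarith)]; ring

namespace IsSteadyState

variable {F : ℝ → ℝ} {eStar : WithTop ℝ} {m₀ : ℝ} {f₀ : ℝ × ℝ → ℝ}

theorem rearr_terms_lt_top (h : IsSteadyState F eStar m₀ f₀) {f : ℝ × ℝ → ℝ} (hf : Measurable f)
    (hfE : InEnergySpace f) :
    distL1 (rearr f) (rearr f₀) < ⊤ ∧ betaTerm f f₀ < ⊤ := by
  refine ⟨distL1_rearr_lt_top hf h.measurable hfE.integrable.lintegral_lt_top.ne
    h.energy_space.integrable.lintegral_lt_top.ne,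
    betaTerm_lt_top h.measurable h.energy_space.integrable.lintegral_lt_top.ne ?_⟩
  simp_rw [← ENNReal.ofReal_mul (sq_nonneg _)]
  exact h.energy_space.integrable_kinetic.lintegral_lt_top.ne

theorem quantitative_bound (h : IsSteadyState F eStar m₀ f₀) :
    ∃ W : ℝ, 0 < W ∧ ∀ f : ℝ × ℝ → ℝ, Measurable f → (∀ p, 0 ≤ f p) → InEnergySpace f →
      (∫ p, max (f₀ p - f p) 0 ∂phase) ^ 2 ≤ 4 * W *
        ((∫ p, energy m₀ p * (f p - f₀ p) ∂phase) + m₀ * (distL1 (rearr f) (rearr f₀)).toReal +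
          1 / (8 * Real.pi ^ 2) * (betaTerm f f₀).toReal) := by
  obtain ⟨W, hW, hbound⟩ := h.decrementBound_univ
  have hm := h.m₀_pos
  -- Adding `1` makes the constant strictly positive, as the optimization in `τ` requires.
  refine ⟨W.toReal + 1, by positivity, fun f hf hf0 hfE => ?_⟩
  have hf₀0 : ∀ p, 0 ≤ f₀ p := fun p => by rw [h.profile_eq]; exact h.nonneg _
  have hi := hfE.integrable
  have hi₀ := h.energy_space.integrable
  obtain ⟨hd, hb⟩ := h.rearr_terms_lt_top hf hfE
  have hmass : ∀ {g : ℝ × ℝ → ℝ}, Integrable g phase → (∀ p, 0 ≤ g p) →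
      ∫⁻ p, ENNReal.ofReal (g p) ∂phase = ENNReal.ofReal (∫ p, g p ∂phase) := fun hg hg0 =>
    (ofReal_integral_eq_lintegral_ofReal hg (ae_of_all _ hg0)).symm
  have hE0 : ∀ p, 0 ≤ energy m₀ p + m₀ := fun p => by linarith [neg_le_energy hm p]
  have hen : ∀ {g : ℝ × ℝ → ℝ}, InEnergySpace g → (∀ p, 0 ≤ g p) →
      ∫⁻ p, ENNReal.ofReal (energy m₀ p + m₀) * ENNReal.ofReal (g p) ∂phase =
        ENNReal.ofReal ((∫ p, energy m₀ p * g p ∂phase) + m₀ * ∫ p, g p ∂phase) := by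
    intro g hg hg0
    have hs : Integrable (fun p => energy m₀ p * g p + m₀ * g p) phase :=
      (hg.integrable_energy m₀).add (hg.integrable.const_mul m₀)
    rw [← integral_const_mul, ← integral_add (hg.integrable_energy m₀) (hg.integrable.const_mul m₀),
      ofReal_integral_eq_lintegral_ofReal hs
        (ae_of_all _ fun p => (mul_nonneg (hE0 p) (hg0 p)).trans_eq (add_mul _ _ _))]
    refine lintegral_congr fun p => ?_
    rw [← ENNReal.ofReal_mul (hE0 p), add_mul]
  have hen0 : ∀ {g : ℝ × ℝ → ℝ}, InEnergySpace g → (∀ p, 0 ≤ g p) →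
      0 ≤ (∫ p, energy m₀ p * g p ∂phase) + m₀ * ∫ p, g p ∂phase := by
    intro g hg hg0
    rw [← integral_const_mul, ← integral_add (hg.integrable_energy m₀) (hg.integrable.const_mul m₀)]
    refine integral_nonneg fun p => ?_
    simp only [← add_mul]
    exact mul_nonneg (hE0 p) (hg0 p)
  have hdiff : ∫⁻ p, (ENNReal.ofReal (f₀ p) - ENNReal.ofReal (f p)) ∂phase =
      ENNReal.ofReal (∫ p, max (f₀ p - f p) 0 ∂phase) := by
    have hmax : Integrable (fun p => max (f₀ p - f p) 0) phase := (hi₀.sub hi).pos_part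
    rw [ofReal_integral_eq_lintegral_ofReal hmax (ae_of_all _ fun p => le_max_right _ _)]
    refine lintegral_congr fun p => ?_
    rw [← ENNReal.ofReal_sub _ (hf0 p), ENNReal.ofReal_max, ENNReal.ofReal_zero, max_eq_left zero_le]
  have hI0 : 0 ≤ ∫ p, max (f₀ p - f p) 0 ∂phase := integral_nonneg fun p => le_max_right _ _
  have hsub : ∫ p, energy m₀ p * (f p - f₀ p) ∂phase =
      (∫ p, energy m₀ p * f p ∂phase) - ∫ p, energy m₀ p * f₀ p ∂phase := by
    rw [← integral_sub (hfE.integrable_energy m₀) (h.energy_space.integrable_energy m₀)]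
    simp only [mul_sub]
  have hN0 : 0 ≤ ∫ p, f p ∂phase := integral_nonneg hf0
  have hN₀0 : 0 ≤ ∫ p, f₀ p ∂phase := integral_nonneg hf₀0
  refine sq_le_of_forall_mul_le (by positivity) (fun τ hτ => ?_) hI0
  have hcomp := h.lintegral_comparison hf hi.lintegral_lt_top.ne hi₀.lintegral_lt_top.ne hτ
  have hdec : ∫⁻ p, (ENNReal.ofReal (F (energy m₀ p)) - ENNReal.ofReal (F (energy m₀ p + τ))) ∂phase ≤
      ENNReal.ofReal (W.toReal * τ) := by
    rw [ENNReal.ofReal_mul ENNReal.toReal_nonneg, ENNReal.ofReal_toReal hW]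
    simpa using hbound τ hτ
  replace hcomp := hcomp.trans (add_le_add le_rfl (mul_le_mul_right hdec _))
  have hX := hen0 hfE hf0
  have hX₀ := hen0 h.energy_space hf₀0
  have hD := ENNReal.toReal_nonneg (a := distL1 (rearr f) (rearr f₀))
  have hT := ENNReal.toReal_nonneg (a := betaTerm f f₀)
  have hWτ : 0 ≤ W.toReal * τ := mul_nonneg ENNReal.toReal_nonneg hτ
  rw [hdiff, hen hfE hf0, hen h.energy_space hf₀0, hmass hi hf0, hmass hi₀ hf₀0,
    ← ENNReal.ofReal_toReal hd.ne, ← ENNReal.ofReal_toReal hb.ne] at hcomp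
  simp only [← ENNReal.ofReal_mul hτ, ← ENNReal.ofReal_mul hm.le,
    ← ENNReal.ofReal_mul (show 0 ≤ 1 / (8 * Real.pi ^ 2) by positivity)] at hcomp
  rw [← ENNReal.ofReal_add (by positivity) hX₀, ← ENNReal.ofReal_add (by positivity) (by positivity),
    ← ENNReal.ofReal_add hX (by positivity), ← ENNReal.ofReal_add (by positivity) (by positivity),
    ← ENNReal.ofReal_add (by positivity) (by positivity),
    ← ENNReal.ofReal_add (by positivity) (by positivity),
    ENNReal.ofReal_le_ofReal_iff (by positivity)] at hcomp
  rw [hsub]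
  nlinarith [mul_nonneg hτ hτ]

theorem integrable_energy_mul_sub (h : IsSteadyState F eStar m₀ f₀) {f : ℝ × ℝ → ℝ}
    (hf : InEnergySpace f) : Integrable (fun p => energy m₀ p * (f p - f₀ p)) phase := by
  simp only [mul_sub]
  exact (hf.integrable_energy m₀).sub (h.energy_space.integrable_energy m₀)

theorem energy_eq (h : IsSteadyState F eStar m₀ f₀) (p : ℝ × ℝ) :
    p.2 ^ 2 / 2 + potential f₀ p.1 = energy m₀ p := by
  rw [h.self_consistent, energy]

end IsSteadyState

/-- Every term of the inequality depends on `f` only up to null sets, so a measurable, everywhere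
nonnegative representative suffices. -/
theorem exists_measurable_nonneg_congr {f : ℝ × ℝ → ℝ} (hf0 : 0 ≤ᵐ[phase] f)
    (hf : Integrable f phase) : ∃ g, Measurable g ∧ (∀ p, 0 ≤ g p) ∧ f =ᵐ[phase] g := by
  obtain ⟨g, hg, hfg⟩ := hf.aemeasurable
  refine ⟨fun p => max (g p) 0, hg.max measurable_const, fun p => le_max_right _ _, ?_⟩
  filter_upwards [hf0, hfg] with p hp0 hpg
  rw [← hpg]
  exact (max_eq_left hp0).symm

end HMF

theorem mainTheorem6 (f₀ : ℝ × ℝ → ℝ) (m₀ : ℝ)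
    (hf₀ : ∃ (F : ℝ → ℝ) (eStar : WithTop ℝ), HMF.IsSteadyState F eStar m₀ f₀) :
    ∃ K₀ : ℝ, 0 < K₀ ∧ ∀ f : ℝ × ℝ → ℝ, 0 ≤ᵐ[HMF.phase] f → HMF.InEnergySpace f →
      Integrable (fun p : ℝ × ℝ => (p.2 ^ 2 / 2 + HMF.potential f₀ p.1) * (f p - f₀ p))
        HMF.phase ∧
      HMF.distL1 (HMF.rearr f) (HMF.rearr f₀) < ⊤ ∧
      HMF.betaTerm f f₀ < ⊤ ∧
      (HMF.normL1 (fun p => f p - f₀ p) + HMF.normL1 f₀ - HMF.normL1 f) ^ 2 ≤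
        K₀ * ((∫ p, (p.2 ^ 2 / 2 + HMF.potential f₀ p.1) * (f p - f₀ p) ∂HMF.phase)
          + m₀ * (HMF.distL1 (HMF.rearr f) (HMF.rearr f₀)).toReal
          + 1 / (8 * Real.pi ^ 2) * (HMF.betaTerm f f₀).toReal) := by
  obtain ⟨F, eStar, h⟩ := hf₀
  obtain ⟨W, hW, hbound⟩ := h.quantitative_bound
  -- The left side is `(2I)²`, and `I² ≤ 4 W B`.
  refine ⟨16 * W, by positivity, fun f hf0 hfE => ?_⟩
  simp only [h.energy_eq]
  obtain ⟨g, hg, hg0, hfg⟩ := HMF.exists_measurable_nonneg_congr hf0 hfE.integrable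
  have hgE := hfE.congr hfg
  have hrearr := HMF.rearr_congr hfg
  have hbeta : HMF.betaTerm f f₀ = HMF.betaTerm g f₀ := by
    unfold HMF.betaTerm
    rw [hrearr]
  have hsub : HMF.normL1 (fun p => f p - f₀ p) = HMF.normL1 (fun p => g p - f₀ p) :=
    integral_congr_ae (hfg.mono fun p hp => by simp only [hp])
  have hnorm : HMF.normL1 f = HMF.normL1 g :=
    integral_congr_ae (hfg.mono fun p hp => by simp only [hp])
  have hint : ∫ p, HMF.energy m₀ p * (f p - f₀ p) ∂HMF.phase =
      ∫ p, HMF.energy m₀ p * (g p - f₀ p) ∂HMF.phase :=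
    integral_congr_ae (hfg.mono fun p hp => by simp only [hp])
  obtain ⟨hd, hb⟩ := h.rearr_terms_lt_top hg hgE
  refine ⟨h.integrable_energy_mul_sub hfE, hrearr ▸ hd, hbeta ▸ hb, ?_⟩
  have hf₀0 : ∀ p, 0 ≤ f₀ p := fun p => by rw [h.profile_eq]; exact h.nonneg _
  rw [hsub, hnorm, hint, hrearr, hbeta,
    HMF.normL1_sub_add_sub hgE.integrable h.energy_space.integrable hg0 hf₀0]
  linarith [hbound g hg hg0 hgE]
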